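/- Consider a finite two-player zero-sum extensive-form game with perfect recall. For an information set $I$ of player $i=P(I)$ with action set $A(I)$, and an action $a\in A(I)$, let $U(I)$, $L(I)$ be the maximum and minimum payoffs of player $i$ reachable from $I$, let $\Delta(I)=U(I)-L(I)$, let $U(I,a)$ be the maximum payoff of $i$ reachable after playing $a$ at $I$, and let $D(I,a)$ be the set of information sets of player $i$ reachable after playing $a$ at $I$. For a strategy profile $\sigma$ let $v^\sigma(I)=\sum_{h\in I}\pi^\sigma_{-i}(h)\sum_{z}\pi^\sigma(h,z)u_i(z)$ and $v^\sigma(I,a)=\sum_{h\in I}\pi^\sigma_{-i}(h)\sum_{z}\pi^\sigma(h\cdot a,z)u_i(z)$ be the counterfactual values, where $z$ ranges over the terminal histories, $\pi^\sigma(h,z)$ is the probability of reaching $z$ from $h$, and $\pi^\sigma_{-i}(h)$, $\pi_i^\sigma(h)$ are the contributions of all others (with chance) and of $i$ to the probability of reaching $h$. For a run $\sigma^1,\sigma^2,\dots$ let $R^t(I,a)=\sum_{s\le t}\big(v^{\sigma^s}(I,a)-v^{\sigma^s}(I)\big)$, and let $\bar\sigma^T$ be the average profile, $\bar\sigma^T(I)=\sum_{t\le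 T}\pi_i^{\sigma^t}(I)\sigma^t(I)\big/\sum_{t\le T}\pi_i^{\sigma^t}(I)$ (uniform if the denominator vanishes). CFR with regret matching (RM) plays $\sigma^{t+1}(I,\cdot)$ proportional to $\max\{R^t(I,\cdot),0\}$, and uniformly if all of these vanish. Fix tolerances $0\le x^T_J\le \Delta(J)^2|A(J)|\,T$ (the right-hand side is the CFR bound on $\sum_{b}\max\{R^T(J,b),0\}^2$). A strategy $\sigma'_i$ is a $T$-near counterfactual best response to $\sigma_{-i}$ if $\sum_{b\in A(J)}\big(v^{\langle\sigma'_i,\sigma_{-i}\rangle}(J,b)-v^{\langle\sigma'_i,\sigma_{-i}\rangle}(J)\big)_+^2\le x_J^T/T^2$ for every information set $J$ of $i$, and $NBV^{\sigma_{-i},T}(J)$, $NBV^{\sigma_{-i},T}(J,b)$ are the minima of $v^{\langle\sigma'_i,\sigma_{-i}\rangle}(J)$, $v^{\langle\sigma'_i,\sigma_{-i}\rangle}(J,b)$ over these strategies. **Theorem.** Let $T\ge 1$ iterations of CFR with RM have been played, let $P(I)=i$, $a\in A(I)$, and suppose $$T\cdot NBV^{\bar\sigma^T_{-i},T}(I,a)\le\sum_{t=1}^T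 v^{\sigma^t}(I).$$ Let $T'=\Big\lfloor\frac{\sum_{t=1}^T v^{\sigma^t}(I)-T\cdot NBV^{\bar\sigma^T_{-i},T}(I,a)}{U(I,a)-L(I)}\Big\rfloor$ (any natural number if $U(I,a)=L(I)$), and suppose $x_J^{T}\le x_J^{T+T'}$ for all $J\in D(I,a)$. Suppose that in the next $T'$ iterations both players play according to CFR with RM in all information sets outside $D(I,a)$, except that $\sigma(I,a)$ is set to zero and $\sigma(I)$ is renormalized, while play in $D(I,a)$ is arbitrary. Then $$(T+T')\,NBV^{\bar\sigma^{T+T'}_{-i},T+T'}(I,a)\le\sum_{t=1}^{T+T'}v^{\sigma^t}(I).$$ Moreover, suppose that for every $t\le T+T'$ one then sets $v^{\sigma^t}(I,a)=NBV^{\bar\sigma^{T+T'}_{-i},T+T'}(I,a)$ and, for all $I'\in D(I,a)$ and $a'\in A(I')$, $v^{\sigma^t}(I',a')=NBV^{\bar\sigma^{T+T'}_{-i},T+T'}(I',a')$ and $v^{\sigma^t}(I')=NBV^{\bar\sigma^{T+T'}_{-i},T+T'}(I')$, leaving all other values unchanged, and plays $T''\ge 0$ further iterations of CFR with RM from the resulting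 regrets. Then, with $N=T+T'+T''$, the bounds that $N$ iterations of CFR with RM without pruning guarantee still hold: for each player $j$, $$\max_{\sigma'_j}\sum_{t=1}^{N}\big(u_j(\sigma'_j,\sigma^t_{-j})-u_j(\sigma^t)\big)\le B_j:=\sum_{J:\,P(J)=j}\Delta(J)\sqrt{|A(J)|}\sqrt{N};$$ the sum over the two players of what each can gain by a best response against $\bar\sigma^{N}$ is at most $(B_1+B_2)/N$; and $\bar\sigma^{N}$ is a $2\max\{B_1,B_2\}/N$-equilibrium. -/

import Mathlib

noncomputable section

open scoped Classical

/-- A finite extensive-form game with imperfect information. Histories are finite sequences of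
actions; the set `H` of histories is finite, contains the empty history and is closed under
removing the last action. The actions available at `h` are those `a` with `h ++ [a] ∈ H`, and `h`
is terminal if there are none. At a non-terminal history `turn h` is the player who acts
(`none` is chance). The information sets are indexed by `Info`: every information set belongs to
one player, is a non-empty set of non-terminal histories of this player, and the same actions are
available at all its histories. -/
structure Game (P A Info : Type*) [Fintype A] where
  H : Finset (List A)
  nil_mem : [] ∈ H
  mem_of_snoc_mem : ∀ h a, h ++ [a] ∈ H → h ∈ H
  turn : List A → Option P
  chance : List A → A → ℝ
  chance_nonneg : ∀ h a, turn h = none → h ++ [a] ∈ H → 0 ≤ chance h a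
  chance_sum : ∀ h, turn h = none → (∃ a, h ++ [a] ∈ H) →
    ∑ a with h ++ [a] ∈ H, chance h a = 1
  info : List A → Info
  owner : Info → P
  owner_info : ∀ h i, (∃ a, h ++ [a] ∈ H) → turn h = some i → owner (info h) = i
  acts_info : ∀ h h', (∃ a, h ++ [a] ∈ H) → (∃ a, h' ++ [a] ∈ H) → turn h ≠ none →
    turn h' ≠ none → info h = info h' → ∀ a, h ++ [a] ∈ H ↔ h' ++ [a] ∈ H
  info_nonempty : ∀ I, ∃ h, (∃ a, h ++ [a] ∈ H) ∧ turn h = some (owner I) ∧ info h = I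
  payoff : P → List A → ℝ

namespace Game

variable {P A Info : Type*} [Fintype A] [Fintype Info] (G : Game P A Info)

/-! ### Histories, information sets, payoff ranges -/

/-- Terminal histories. -/
def Z : Finset (List A) := G.H.filter fun h => ∀ a, h ++ [a] ∉ G.H

/-- The histories in the information set `I`. -/
def hist (I : Info) : Finset (List A) :=
  G.H.filter fun h => (∃ a, h ++ [a] ∈ G.H) ∧ G.turn h = some (G.owner I) ∧ G.info h = I

/-- The actions available at `I`. -/
def acts (I : Info) : Finset A :=
  Finset.univ.filter fun a => ∃ h ∈ G.hist I, h ++ [a] ∈ G.H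

/-- The sequence of (information set, action) pairs of player `i` along `h`. -/
def playerSeq (i : P) (h : List A) : List (Info × A) :=
  (List.finRange h.length).filterMap fun k : Fin h.length =>
    if G.turn (h.take k) = some i then some (G.info (h.take k), h.get k) else none

/-- Perfect recall: all histories in an information set agree on the information sets of the
acting player visited before and on the actions taken there. -/
def PerfectRecall : Prop :=
  ∀ I, ∀ h ∈ G.hist I, ∀ h' ∈ G.hist I,
    G.playerSeq (G.owner I) h = G.playerSeq (G.owner I) h'

/-- `D(I,a)`: the information sets that the player acting at `I` can reach after playing `a`. -/
def D (I : Info) (a : A) : Set Info :=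
  {J | G.owner J = G.owner I ∧ ∃ h ∈ G.hist I, ∃ h' ∈ G.hist J, (h ++ [a]) <+: h'}

/-- Payoffs (of the player acting at `I`) reachable from `I`. -/
def payoffs (I : Info) : Set ℝ :=
  {r | ∃ h ∈ G.hist I, ∃ z ∈ G.Z, h <+: z ∧ G.payoff (G.owner I) z = r}

/-- Payoffs (of the player acting at `I`) reachable from `I` after action `a`. -/
def payoffsA (I : Info) (a : A) : Set ℝ :=
  {r | ∃ h ∈ G.hist I, ∃ z ∈ G.Z, (h ++ [a]) <+: z ∧ G.payoff (G.owner I) z = r}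

/-- `U(I)`, a maximum over a finite non-empty set. -/
def U (I : Info) : ℝ := sSup (G.payoffs I)

/-- `L(I)`, a minimum over a finite non-empty set. -/
def L (I : Info) : ℝ := sInf (G.payoffs I)

/-- `U(I,a)`, a maximum over a finite set, non-empty if `a` is available at `I`. -/
def UA (I : Info) (a : A) : ℝ := sSup (G.payoffsA I a)

/-- `Δ(I) = U(I) - L(I)`. -/
def range (I : Info) : ℝ := G.U I - G.L I

/-! ### Strategies and reach probabilities -/

/-- `σ` is a (behavioral) strategy profile: a probability vector over the available actions at
every information set. A strategy of player `i` is the restriction of a profile to the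
information sets of `i`. -/
def IsProfile (σ : Info → A → ℝ) : Prop :=
  ∀ I, (∀ a, 0 ≤ σ I a) ∧ (∀ a, a ∉ G.acts I → σ I a = 0) ∧ ∑ a ∈ G.acts I, σ I a = 1

/-- The profile `⟨σ'_i, σ_{-i}⟩`. -/
def combine (i : P) (σ' σ : Info → A → ℝ) : Info → A → ℝ :=
  fun I => if G.owner I = i then σ' I else σ I

/-- The probability of action `a` at history `h`. -/
def prob (σ : Info → A → ℝ) (h : List A) (a : A) : ℝ :=
  if G.turn h = none then G.chance h a else σ (G.info h) a

/-- `π^σ(h)`. -/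
def reach (σ : Info → A → ℝ) (h : List A) : ℝ :=
  ∏ k : Fin h.length, G.prob σ (h.take k) (h.get k)

/-- `π^σ_i(h)`, the contribution of player `i`. -/
def reachOwn (i : P) (σ : Info → A → ℝ) (h : List A) : ℝ :=
  ∏ k : Fin h.length, if G.turn (h.take k) = some i then G.prob σ (h.take k) (h.get k) else 1

/-- `π^σ_{-i}(h)`, the contribution of chance and all players other than `i`. -/
def reachOther (i : P) (σ : Info → A → ℝ) (h : List A) : ℝ :=
  ∏ k : Fin h.length, if G.turn (h.take k) = some i then 1 else G.prob σ (h.take k) (h.get k)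

/-- `π^σ(h,z)`, the probability of reaching `z` from `h`. -/
def reachFrom (σ : Info → A → ℝ) (h z : List A) : ℝ :=
  if h <+: z then
    ∏ k : Fin z.length, if h.length ≤ (k : ℕ) then G.prob σ (z.take k) (z.get k) else 1
  else 0

/-- `π^σ_i(I)` for the player `i` acting at `I`: the common value of `π^σ_i(h)`, `h ∈ I`
(under perfect recall it does not depend on the representative). -/
def reachInfo (σ : Info → A → ℝ) (I : Info) : ℝ :=
  G.reachOwn (G.owner I) σ (G.info_nonempty I).choose

/-- Expected payoff `u_i(σ)`. -/
def util (i : P) (σ : Info → A → ℝ) : ℝ := ∑ z ∈ G.Z, G.reach σ z * G.payoff i z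

/-- Counterfactual value `v^σ(I)`. -/
def cfv (σ : Info → A → ℝ) (I : Info) : ℝ :=
  ∑ h ∈ G.hist I, G.reachOther (G.owner I) σ h *
    ∑ z ∈ G.Z, G.reachFrom σ h z * G.payoff (G.owner I) z

/-- Counterfactual value `v^σ(I,a)`. -/
def cfvA (σ : Info → A → ℝ) (I : Info) (a : A) : ℝ :=
  ∑ h ∈ G.hist I, G.reachOther (G.owner I) σ h *
    ∑ z ∈ G.Z, G.reachFrom σ (h ++ [a]) z * G.payoff (G.owner I) z

/-- The average strategy profile of the first `T` iterations, where `σ t` is the profile of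
iteration `t + 1`: at each information set the average weighted by the acting player's own reach
probability, and uniform where that player never reached it. -/
def average (σ : ℕ → Info → A → ℝ) (T : ℕ) : Info → A → ℝ := fun I a =>
  if ∑ t ∈ Finset.range T, G.reachInfo (σ t) I = 0 then
    (if a ∈ G.acts I then 1 / ((G.acts I).card : ℝ) else 0)
  else (∑ t ∈ Finset.range T, G.reachInfo (σ t) I * σ t I a) /
    ∑ t ∈ Finset.range T, G.reachInfo (σ t) I

/-- `σ` is an `ε`-equilibrium. -/
def IsEpsEquilibrium (ε : ℝ) (σ : Info → A → ℝ) : Prop :=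
  ∀ i, ∀ σ', G.IsProfile σ' → G.util i (G.combine i σ' σ) ≤ G.util i σ + ε

/-- Total exploitability of a profile: the sum over the players of what they gain by a best
response. -/
def exploitability [Fintype P] (σ : Info → A → ℝ) : ℝ :=
  ∑ i, (sSup {r | ∃ σ', G.IsProfile σ' ∧ G.util i (G.combine i σ' σ) = r} - G.util i σ)

/-! ### Regret matching and the bounds guaranteed by CFR -/

/-- Regret matching over the action set `S` from the regrets `R`. -/
def regretMatching (S : Finset A) (R : A → ℝ) (a : A) : ℝ :=
  if a ∈ S then
    (if 0 < ∑ b ∈ S, max (R b) 0 then max (R a) 0 / ∑ b ∈ S, max (R b) 0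
      else 1 / (S.card : ℝ))
  else 0

/-- `R^t(I,a)` after the first `t` iterations. -/
def regret (σ : ℕ → Info → A → ℝ) (t : ℕ) (I : Info) (a : A) : ℝ :=
  ∑ s ∈ Finset.range t, (G.cfvA (σ s) I a - G.cfv (σ s) I)

/-- The strategy prescribed at `I` by CFR with regret matching after `t` iterations. -/
def cfrStrategy (σ : ℕ → Info → A → ℝ) (t : ℕ) (I : Info) : A → ℝ :=
  regretMatching (G.acts I) (G.regret σ t I)

/-- The CFR bound `Δ(I)² |A(I)| T` on the potential `Φ(R^T(I)) = ∑_a R^T_+(I,a)²`. -/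
def potentialBound (I : Info) (T : ℕ) : ℝ := G.range I ^ 2 * (G.acts I).card * T

/-- The CFR bound `∑_{I ∈ 𝓘_i} Δ(I) √|A(I)| √T` on the regret `R_i^T` of player `i` in the whole
game. -/
def regretBound (i : P) (T : ℕ) : ℝ :=
  ∑ I with G.owner I = i, G.range I * √((G.acts I).card : ℝ) * √(T : ℝ)

/-! ### Near counterfactual best responses -/

/-- The strategy of player `i` in `σ'` is a `T`-near counterfactual best response to `σ_{-i}`,
with tolerances `x I T`. -/
def IsNearCBR (x : Info → ℕ → ℝ) (i : P) (σ : Info → A → ℝ) (T : ℕ) (σ' : Info → A → ℝ) : Prop :=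
  G.IsProfile σ' ∧ ∀ I, G.owner I = i →
    ∑ a ∈ G.acts I,
      (max (G.cfvA (G.combine i σ' σ) I a - G.cfv (G.combine i σ' σ) I) 0) ^ 2
        ≤ x I T / (T : ℝ) ^ 2

/-- `NBV^{σ_{-i},T}(I)` for the player `i` acting at `I`. -/
def NBV (x : Info → ℕ → ℝ) (σ : Info → A → ℝ) (T : ℕ) (I : Info) : ℝ :=
  sInf {r | ∃ σ', G.IsNearCBR x (G.owner I) σ T σ' ∧
    G.cfv (G.combine (G.owner I) σ' σ) I = r}

/-- `NBV^{σ_{-i},T}(I,a)` for the player `i` acting at `I`. -/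
def NBVA (x : Info → ℕ → ℝ) (σ : Info → A → ℝ) (T : ℕ) (I : Info) (a : A) : ℝ :=
  sInf {r | ∃ σ', G.IsNearCBR x (G.owner I) σ T σ' ∧
    G.cfvA (G.combine (G.owner I) σ' σ) I a = r}

/-! ### Pruning an action -/

/-- `q` is `p` with the probability of `a` set to zero and renormalized (nothing is said about
the remaining probabilities in the degenerate case `p a = 1`). -/
def IsRenormalized (p : A → ℝ) (a : A) (q : A → ℝ) : Prop :=
  q a = 0 ∧ ∀ b, b ≠ a → q b * (1 - p a) = p b

/-- On the iteration after the first `t` ones, both players follow CFR with regret matching outside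
`D(I,a)`, except that `a` is not played at `I`; play in `D(I,a)` is unrestricted. -/
def PrunedStep (σ : ℕ → Info → A → ℝ) (I : Info) (a : A) (t : ℕ) : Prop :=
  (∀ J, J ∉ G.D I a → J ≠ I → σ t J = G.cfrStrategy σ t J) ∧
    IsRenormalized (G.cfrStrategy σ t I) a (σ t I)

/-- The values `v(J)` on iteration `s + 1` after the reset at time `S`. -/
def resetCfv (x : Info → ℕ → ℝ) (σ : ℕ → Info → A → ℝ) (I : Info) (a : A) (S : ℕ)
    (s : ℕ) (J : Info) : ℝ :=
  if s < S ∧ J ∈ G.D I a then G.NBV x (G.average σ S) S J else G.cfv (σ s) J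

/-- The values `v(J,b)` on iteration `s + 1` after the reset at time `S`. -/
def resetCfvA (x : Info → ℕ → ℝ) (σ : ℕ → Info → A → ℝ) (I : Info) (a : A) (S : ℕ)
    (s : ℕ) (J : Info) (b : A) : ℝ :=
  if s < S ∧ (J ∈ G.D I a ∨ (J = I ∧ b = a)) then G.NBVA x (G.average σ S) S J b
  else G.cfvA (σ s) J b

/-- The regrets after the first `t` iterations when the values of the first `S` iterations have
been reset. -/
def resetRegret (x : Info → ℕ → ℝ) (σ : ℕ → Info → A → ℝ) (I : Info) (a : A) (S : ℕ)
    (t : ℕ) (J : Info) (b : A) : ℝ :=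
  ∑ s ∈ Finset.range t, (G.resetCfvA x σ I a S s J b - G.resetCfv x σ I a S s J)

end Game

end

/-!
Fix a player `i`. By perfect recall the terminal histories are grouped by the sequence of pairs
(information set, action) of `i` along them, and every value that `i` can obtain against given
opponents has the form `seqVal i w τ s`: a sum over the terminal histories `z` below a sequence `s`
of a weight `w z`, which collects chance, the opponents and the payoff, times the probability that
`τ` makes the remaining choices of `i`. This is linear in `w`, so that values against an average
strategy are averages of values (`own_average`, `cfWeight_average`), and it satisfies the recursion
of a one-player decision problem (`seqVal_rec`).

Near best responses. At a single information set, among the mixtures whose positive regrets are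
small, there is one of least value, and this value is monotone in the values of the actions and
antitone in the tolerance (`exists_min_mixture`). By backward induction a single near best response
attains all the near best response values at once, and these are monotone in the weights
(`exists_minimal_near`). Adding one multiple of the opponents' reach probability to the weights
changes no regret, so the payoffs of the pruned iterations may be shifted by `U(I,a)`, which makes
them non-positive below `a`. Hence the cumulative near best response value of `a` grows by at most
`U(I,a)` per iteration, weighted by the probability that the others reach `I` (`mul_NBVA_add_le`),
while the cumulative value of `I` grows by at least `L(I)` in the same sense. The number of pruned
iterations is chosen so that the pruning condition survives (`mul_NBVA_le_sum_cfv`).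

Regrets. The regret of a player is the sum of the advantages of the comparison strategy over any
value functions that satisfy the recursion of values (`seqVal_nil_sub`). These may therefore be the
values of the play of the run, except below the pruned action and before the reset, where the
minimal near best response replaces it; the cumulative regrets then are exactly the reset ones
(`sum_util_sub_le_resetRegret`). Their potentials obey the CFR bound (`potential_resetRegret_le`):
regret matching, also with one action removed, increases the potential by at most the squares of
the new regrets; a near best response has a small potential by definition; and the reset regret of
the pruned action is not positive by the pruning condition. The bounds on exploitability and the
equilibrium property follow from linearity and the zero-sum condition.
-/

noncomputable section

open scoped Classical

namespace Game

/-! ### Histories and the sequences of a player -/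

section

/-- All the reach probabilities are products of this form along a history. -/
theorem prod_path_snoc {A : Type*} (f : List A → A → ℝ) (h : List A) (a : A) :
    ∏ k : Fin (h ++ [a]).length, f ((h ++ [a]).take k) ((h ++ [a]).get k) =
      (∏ k : Fin h.length, f (h.take k) (h.get k)) * f h a := by
  have e : h.length + 1 = (h ++ [a]).length := by simp
  rw [← Equiv.prod_comp (finCongr e), Fin.prod_univ_castSucc]
  congr 1
  · refine Finset.prod_congr rfl fun k _ => ?_
    have hk : (k : ℕ) ≤ h.length := k.2.le
    simp [List.take_append_of_le_length hk, List.getElem_append_left k.2]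
  · simp

section

variable {A Info : Type*}

/-- The probability with which the strategy `τ` makes all the choices in a list of
(information set, action) pairs. -/
def own (τ : Info → A → ℝ) (l : List (Info × A)) : ℝ := (l.map fun p => τ p.1 p.2).prod

@[simp] theorem own_nil (τ : Info → A → ℝ) : own τ [] = 1 := rfl

theorem own_append (τ : Info → A → ℝ) (l l' : List (Info × A)) :
    own τ (l ++ l') = own τ l * own τ l' := by simp [own]

theorem own_cons (τ : Info → A → ℝ) (K : Info) (c : A) (l : List (Info × A)) :
    own τ ((K, c) :: l) = τ K c * own τ l := by simp [own]

theorem own_singleton (τ : Info → A → ℝ) (p : Info × A) : own τ [p] = τ p.1 p.2 := by simp [own]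

end

variable {P A Info : Type*} [Fintype A] (G : Game P A Info)

theorem mem_H_of_prefix {h z : List A} (hz : z ∈ G.H) (h1 : h <+: z) : h ∈ G.H := by
  induction z using List.reverseRecOn with
  | nil => simpa [List.prefix_nil.1 h1] using hz
  | append_singleton z a ih =>
    rcases List.prefix_concat_iff.1 h1 with rfl | h2
    · exact hz
    · exact ih (G.mem_of_snoc_mem _ _ hz) h2

@[simp] theorem playerSeq_nil (i : P) : G.playerSeq i [] = [] := by simp [playerSeq]

theorem playerSeq_snoc (i : P) (h : List A) (a : A) :
    G.playerSeq i (h ++ [a]) =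
      G.playerSeq i h ++ if G.turn h = some i then [(G.info h, a)] else [] := by
  have key : ∀ n (e : n = (h ++ [a]).length), G.playerSeq i (h ++ [a]) =
      (List.finRange n).filterMap fun k : Fin n =>
        if G.turn ((h ++ [a]).take k) = some i then
          some (G.info ((h ++ [a]).take k), (h ++ [a]).get (k.cast e)) else none := by
    rintro n rfl; rfl
  rw [key (h.length + 1) (by simp), List.finRange_succ_last, List.filterMap_append]
  congr 1
  · rw [List.filterMap_map, playerSeq]
    refine List.filterMap_congr fun k _ => ?_
    have hk : (k : ℕ) ≤ h.length := k.2.le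
    simp [List.take_append_of_le_length hk, List.getElem_append_left k.2]
  · by_cases ht : G.turn h = some i <;> simp [ht]

@[simp] theorem reachOther_nil (i : P) (σ : Info → A → ℝ) : G.reachOther i σ [] = 1 := by
  simp [reachOther]

theorem reachOther_snoc (i : P) (σ : Info → A → ℝ) (h : List A) (a : A) :
    G.reachOther i σ (h ++ [a]) =
      G.reachOther i σ h * if G.turn h = some i then 1 else G.prob σ h a :=
  prod_path_snoc (fun h a => if G.turn h = some i then 1 else G.prob σ h a) h a

theorem reachOwn_snoc (i : P) (σ : Info → A → ℝ) (h : List A) (a : A) :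
    G.reachOwn i σ (h ++ [a]) =
      G.reachOwn i σ h * if G.turn h = some i then G.prob σ h a else 1 :=
  prod_path_snoc (fun h a => if G.turn h = some i then G.prob σ h a else 1) h a

theorem reachFrom_snoc (σ : Info → A → ℝ) {g h : List A} (hg : g <+: h) (a : A) :
    G.reachFrom σ g (h ++ [a]) = G.reachFrom σ g h * G.prob σ h a := by
  have key : ∀ z, g <+: z → G.reachFrom σ g z = ∏ k : Fin z.length,
      (fun l b => if g.length ≤ l.length then G.prob σ l b else 1) (z.take k) (z.get k) := by
    intro z hz
    rw [reachFrom, if_pos hz]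
    refine Finset.prod_congr rfl fun k _ => ?_
    simp [k.2.le]
  rw [key _ (hg.trans (List.prefix_append _ _)), key _ hg]
  refine (prod_path_snoc (fun l b => if g.length ≤ l.length then G.prob σ l b else 1) h a).trans ?_
  simp [hg.length_le]

theorem reachFrom_self (σ : Info → A → ℝ) (h : List A) : G.reachFrom σ h h = 1 := by
  rw [reachFrom, if_pos (List.prefix_refl h)]
  refine Finset.prod_eq_one fun k _ => if_neg (not_le.2 k.2)

theorem reachOwn_eq_own (i : P) (σ : Info → A → ℝ) (h : List A) :
    G.reachOwn i σ h = own σ (G.playerSeq i h) := by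
  induction h using List.reverseRecOn with
  | nil => simp [reachOwn]
  | append_singleton h a ih =>
    rw [reachOwn_snoc, playerSeq_snoc, own_append, ih]
    by_cases ht : G.turn h = some i <;> simp [ht, prob, own_singleton]

theorem reach_eq (i : P) (σ : Info → A → ℝ) (h : List A) :
    G.reach σ h = G.reachOther i σ h * own σ (G.playerSeq i h) := by
  rw [← reachOwn_eq_own, reach, reachOther, reachOwn, ← Finset.prod_mul_distrib]
  refine Finset.prod_congr rfl fun k _ => ?_
  split_ifs <;> simp

theorem playerSeq_prefix (i : P) {g h : List A} (hg : g <+: h) :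
    G.playerSeq i g <+: G.playerSeq i h := by
  induction h using List.reverseRecOn with
  | nil => simp [List.prefix_nil.1 hg]
  | append_singleton h a ih =>
    rcases List.prefix_concat_iff.1 hg with rfl | h2
    · exact List.prefix_refl _
    · rw [playerSeq_snoc]; exact (ih h2).trans (List.prefix_append _ _)

/-- Play of the others up to `g` and of everybody from `g` to `h` is play of the others up to `h` and
of player `i` from `g` to `h`. -/
theorem reachOther_mul_reachFrom (i : P) (σ : Info → A → ℝ) {g h : List A} (hg : g <+: h) :
    G.reachOther i σ g * G.reachFrom σ g h =
      G.reachOther i σ h * own σ ((G.playerSeq i h).drop (G.playerSeq i g).length) := by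
  induction h using List.reverseRecOn with
  | nil => simp [List.prefix_nil.1 hg, reachFrom_self]
  | append_singleton h a ih =>
    rcases List.prefix_concat_iff.1 hg with rfl | h2
    · simp [reachFrom_self]
    · rw [reachFrom_snoc _ _ h2, ← mul_assoc, ih h2, playerSeq_snoc, reachOther_snoc,
        List.drop_append_of_le_length (G.playerSeq_prefix i h2).length_le, own_append]
      by_cases ht : G.turn h = some i
      · simp [ht, own_singleton, prob]; ring
      · simp [ht]; ring

theorem prob_nonneg {σ : Info → A → ℝ} (hσ : G.IsProfile σ) {h : List A} {a : A}
    (ha : h ++ [a] ∈ G.H) : 0 ≤ G.prob σ h a := by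
  rw [prob]
  split_ifs with ht
  · exact G.chance_nonneg _ _ ht ha
  · exact (hσ _).1 _

theorem reachOther_nonneg (i : P) {σ : Info → A → ℝ} (hσ : G.IsProfile σ) {h : List A}
    (hh : h ∈ G.H) : 0 ≤ G.reachOther i σ h := by
  induction h using List.reverseRecOn with
  | nil => simp
  | append_singleton h a ih =>
    rw [reachOther_snoc]
    refine mul_nonneg (ih (G.mem_of_snoc_mem _ _ hh)) ?_
    split_ifs
    · exact zero_le_one
    · exact G.prob_nonneg hσ hh

theorem own_nonneg {σ : Info → A → ℝ} (hσ : G.IsProfile σ) (l : List (Info × A)) :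
    0 ≤ own σ l := by
  refine List.prod_nonneg fun r hr => ?_
  obtain ⟨p, _, rfl⟩ := List.mem_map.1 hr
  exact (hσ _).1 _

theorem IsProfile.le_one {σ : Info → A → ℝ} (hσ : G.IsProfile σ) (K : Info) (c : A) :
    σ K c ≤ 1 := by
  by_cases hc : c ∈ G.acts K
  · rw [← (hσ K).2.2]
    exact Finset.single_le_sum (f := σ K) (fun b _ => (hσ K).1 b) hc
  · rw [(hσ K).2.1 c hc]; exact zero_le_one

theorem own_le_one {σ : Info → A → ℝ} (hσ : G.IsProfile σ) (l : List (Info × A)) :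
    own σ l ≤ 1 := by
  induction l with
  | nil => simp
  | cons p l ih =>
    rw [own_cons]
    exact mul_le_one₀ (hσ.le_one G _ _) (G.own_nonneg hσ _) ih

theorem mem_hist_info {i : P} {h : List A} {a : A} (ha : h ++ [a] ∈ G.H)
    (ht : G.turn h = some i) : h ∈ G.hist (G.info h) ∧ G.owner (G.info h) = i := by
  have := G.owner_info h i ⟨a, ha⟩ ht
  exact ⟨by simp [hist, G.mem_of_snoc_mem _ _ ha, this, ht]; exact ⟨a, ha⟩, this⟩

theorem turn_of_mem_hist {K : Info} {h : List A} (hh : h ∈ G.hist K) :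
    G.turn h = some (G.owner K) := (Finset.mem_filter.1 hh).2.2.1

theorem info_of_mem_hist {K : Info} {h : List A} (hh : h ∈ G.hist K) :
    G.info h = K := (Finset.mem_filter.1 hh).2.2.2

theorem mem_acts_iff {K : Info} {h : List A} (hh : h ∈ G.hist K) (a : A) :
    a ∈ G.acts K ↔ h ++ [a] ∈ G.H := by
  simp only [acts, Finset.mem_filter, Finset.mem_univ, true_and]
  refine ⟨?_, fun ha => ⟨h, hh, ha⟩⟩
  rintro ⟨g, hg, hga⟩
  refine (G.acts_info g h (Finset.mem_filter.1 hg).2.1 (Finset.mem_filter.1 hh).2.1 ?_ ?_ ?_ a).1 hga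
  · simp [G.turn_of_mem_hist hg]
  · simp [G.turn_of_mem_hist hh]
  · rw [G.info_of_mem_hist hg, G.info_of_mem_hist hh]

/-- A history in the information set `K`. -/
def rep (K : Info) : List A := (G.info_nonempty K).choose

theorem rep_mem (K : Info) : G.rep K ∈ G.hist K := by
  obtain ⟨⟨a, ha⟩, ht, hK⟩ := (G.info_nonempty K).choose_spec
  exact Finset.mem_filter.2 ⟨G.mem_of_snoc_mem _ _ ha, ⟨a, ha⟩, ht, hK⟩

theorem acts_nonempty (K : Info) : (G.acts K).Nonempty := by
  obtain ⟨a, ha⟩ := (Finset.mem_filter.1 (G.rep_mem K)).2.1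
  exact ⟨a, (G.mem_acts_iff (G.rep_mem K) a).2 ha⟩

/-- The sequence of the player acting at `K` that leads to `K`, read off from one history in `K`; with
perfect recall all of them give the same. -/
def seqI (K : Info) : List (Info × A) := G.playerSeq (G.owner K) (G.rep K)

/-- The sequence that leads to `K` followed by the action `c` there. -/
def seqA (K : Info) (c : A) : List (Info × A) := G.seqI K ++ [(K, c)]

variable {G} in
theorem seqA_inj {K K' : Info} {c c' : A} : G.seqA K c = G.seqA K' c' ↔ K = K' ∧ c = c' := by
  constructor
  · intro h
    simpa using (List.append_inj' h rfl).2
  · rintro ⟨rfl, rfl⟩; rfl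

variable {G} in
theorem seqA_prefix_seqA {K K' : Info} {c c' : A} :
    G.seqA K c <+: G.seqA K' c' ↔ (K' = K ∧ c' = c) ∨ G.seqA K c <+: G.seqI K' := by
  change G.seqA K c <+: G.seqI K' ++ [(K', c')] ↔ _
  rw [List.prefix_concat_iff, ← seqA, seqA_inj, eq_comm, eq_comm (a := c)]

theorem reachInfo_eq (σ : Info → A → ℝ) (K : Info) : G.reachInfo σ K = own σ (G.seqI K) :=
  G.reachOwn_eq_own _ _ _

variable {G}

theorem PerfectRecall.playerSeq_eq (hG : G.PerfectRecall) {K : Info} {h : List A}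
    (hh : h ∈ G.hist K) : G.playerSeq (G.owner K) h = G.seqI K :=
  hG K h hh _ (G.rep_mem K)

theorem playerSeq_snoc_hist (hG : G.PerfectRecall) {K : Info} {h : List A}
    (hh : h ∈ G.hist K) (c : A) : G.playerSeq (G.owner K) (h ++ [c]) = G.seqA K c := by
  rw [playerSeq_snoc, if_pos (G.turn_of_mem_hist hh), G.info_of_mem_hist hh, hG.playerSeq_eq hh,
    seqA]

/-- Every pair on the sequence of a history comes from a history in that information set. -/
theorem exists_of_prefix_playerSeq {i : P} {h : List A} (hh : h ∈ G.H)
    {p : List (Info × A)} {K : Info} {c : A} (hp : p ++ [(K, c)] <+: G.playerSeq i h) :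
    G.owner K = i ∧ ∃ g ∈ G.hist K, g ++ [c] <+: h ∧ G.playerSeq i g = p := by
  induction h using List.reverseRecOn with
  | nil => simp at hp
  | append_singleton h a ih =>
    have hh' := G.mem_of_snoc_mem _ _ hh
    rw [playerSeq_snoc] at hp
    split_ifs at hp with ht
    · rcases List.prefix_concat_iff.1 hp with h1 | h1
      · obtain ⟨h2, h3⟩ := List.append_inj' h1 rfl
        simp only [List.cons.injEq, Prod.mk.injEq, and_true] at h3
        obtain ⟨rfl, rfl⟩ := h3
        have := G.mem_hist_info hh ht
        exact ⟨this.2, h, this.1, List.prefix_refl _, h2.symm⟩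
      · obtain ⟨h2, g, h3, h4, h5⟩ := ih hh' h1
        exact ⟨h2, g, h3, h4.trans (List.prefix_append _ _), h5⟩
    · obtain ⟨h2, g, h3, h4, h5⟩ := ih hh' (by simpa using hp)
      exact ⟨h2, g, h3, h4.trans (List.prefix_append _ _), h5⟩

/-- With perfect recall, the part of a sequence before the pair `(K, c)` is determined by `K`. -/
theorem prefix_playerSeq (hG : G.PerfectRecall) {i : P} {h : List A} (hh : h ∈ G.H)
    {p : List (Info × A)} {K : Info} {c : A} (hp : p ++ [(K, c)] <+: G.playerSeq i h) :
    G.owner K = i ∧ p = G.seqI K ∧ c ∈ G.acts K := by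
  obtain ⟨rfl, g, hg, hgc, rfl⟩ := exists_of_prefix_playerSeq hh hp
  exact ⟨rfl, hG.playerSeq_eq hg, (G.mem_acts_iff hg c).2 (G.mem_H_of_prefix hh hgc)⟩

/-- A history passes through an information set at most once. -/
theorem hist_unique (hG : G.PerfectRecall) {K : Info} {g g' h : List A} (hg : g ∈ G.hist K)
    (hg' : g' ∈ G.hist K) (h1 : g <+: h) (h2 : g' <+: h) : g = g' := by
  have key : ∀ {g g' : List A}, g ∈ G.hist K → g' ∈ G.hist K → g <+: g' → g = g' := by
    rintro g g' hg hg' ⟨t, rfl⟩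
    cases t with
    | nil => simp
    | cons c t =>
      have h3 : g ++ [c] <+: g ++ c :: t := by simp
      have h4 := (G.playerSeq_prefix (G.owner K) h3).length_le
      rw [playerSeq_snoc_hist hG hg, hG.playerSeq_eq hg', seqA] at h4
      simp at h4
  rcases List.prefix_or_prefix_of_prefix h1 h2 with h3 | h3
  · exact key hg hg' h3
  · exact (key hg' hg h3).symm

/-- With perfect recall, `D(I,a)` consists of the information sets whose sequence passes through
`(I, a)`. -/
theorem mem_D_iff (hG : G.PerfectRecall) {I J : Info} {a : A} :
    J ∈ G.D I a ↔ G.owner J = G.owner I ∧ G.seqA I a <+: G.seqI J := by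
  constructor
  · rintro ⟨h1, h, hh, h', hh', hp⟩
    refine ⟨h1, ?_⟩
    have := G.playerSeq_prefix (G.owner I) hp
    rwa [playerSeq_snoc_hist hG hh, ← h1, hG.playerSeq_eq hh'] at this
  · rintro ⟨h1, hp⟩
    rw [seqI, h1] at hp
    obtain ⟨_, g, hg, hgc, _⟩ :=
      exists_of_prefix_playerSeq (Finset.mem_filter.1 (G.rep_mem J)).1 hp
    exact ⟨h1, g, hg, _, G.rep_mem J, hgc⟩

theorem not_mem_D_self (hG : G.PerfectRecall) {I : Info} {a : A} : I ∉ G.D I a := fun h => by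
  have := ((mem_D_iff hG).1 h).2.length_le
  simp [seqA] at this

end

/-! ### Values in sequence form -/

section

variable {P A Info : Type*} [Fintype A] (G : Game P A Info)

/-- The value for player `i` of the sequence `s`: the sum of the weights `w z` of the terminal
histories `z` below `s`, each multiplied by the probability that `τ` makes the choices of `i` that
remain on the way to `z`. The weight collects everything `i` does not control, so that this is
linear in `w`, and all counterfactual values have this form. -/
def seqVal (i : P) (w : List A → ℝ) (τ : Info → A → ℝ) (s : List (Info × A)) : ℝ :=
  ∑ z ∈ G.Z with s <+: G.playerSeq i z, w z * own τ ((G.playerSeq i z).drop s.length)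

/-- The value for player `i` of the information set `K`, in the same sense. -/
def infoVal (i : P) (w : List A → ℝ) (τ : Info → A → ℝ) (K : Info) : ℝ :=
  ∑ c ∈ G.acts K, τ K c * G.seqVal i w τ (G.seqA K c)

theorem seqVal_sum {ι : Type*} (t : Finset ι) (i : P) (w : ι → List A → ℝ)
    (τ : Info → A → ℝ) (s : List (Info × A)) :
    G.seqVal i (fun z => ∑ k ∈ t, w k z) τ s = ∑ k ∈ t, G.seqVal i (w k) τ s := by
  simp only [seqVal]
  rw [Finset.sum_comm]
  exact Finset.sum_congr rfl fun z _ => Finset.sum_mul _ _ _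

theorem seqVal_add (i : P) (w w' : List A → ℝ) (τ : Info → A → ℝ) (s : List (Info × A)) :
    G.seqVal i (fun z => w z + w' z) τ s = G.seqVal i w τ s + G.seqVal i w' τ s := by
  simp only [seqVal, ← Finset.sum_add_distrib, add_mul]

theorem seqVal_const_mul (r : ℝ) (i : P) (w : List A → ℝ) (τ : Info → A → ℝ)
    (s : List (Info × A)) :
    G.seqVal i (fun z => r * w z) τ s = r * G.seqVal i w τ s := by
  simp only [seqVal, Finset.mul_sum, mul_assoc]

theorem infoVal_sum {ι : Type*} (t : Finset ι) (i : P) (w : ι → List A → ℝ)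
    (τ : Info → A → ℝ) (K : Info) :
    G.infoVal i (fun z => ∑ k ∈ t, w k z) τ K = ∑ k ∈ t, G.infoVal i (w k) τ K := by
  simp only [infoVal, seqVal_sum, Finset.mul_sum]
  exact Finset.sum_comm

theorem infoVal_add (i : P) (w w' : List A → ℝ) (τ : Info → A → ℝ) (K : Info) :
    G.infoVal i (fun z => w z + w' z) τ K = G.infoVal i w τ K + G.infoVal i w' τ K := by
  simp only [infoVal, seqVal_add, mul_add, Finset.sum_add_distrib]

theorem infoVal_const_mul (r : ℝ) (i : P) (w : List A → ℝ) (τ : Info → A → ℝ) (K : Info) :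
    G.infoVal i (fun z => r * w z) τ K = r * G.infoVal i w τ K := by
  simp only [infoVal, seqVal_const_mul, Finset.mul_sum]
  exact Finset.sum_congr rfl fun c _ => by ring

theorem seqVal_le {i : P} {w w' : List A → ℝ} {τ : Info → A → ℝ} (hτ : G.IsProfile τ)
    {s : List (Info × A)} (h : ∀ z ∈ G.Z, s <+: G.playerSeq i z → w z ≤ w' z) :
    G.seqVal i w τ s ≤ G.seqVal i w' τ s := by
  refine Finset.sum_le_sum fun z hz => ?_
  obtain ⟨h1, h2⟩ := Finset.mem_filter.1 hz
  exact mul_le_mul_of_nonneg_right (h z h1 h2) (G.own_nonneg hτ _)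

theorem seqVal_nonneg {i : P} {w : List A → ℝ} {τ : Info → A → ℝ} (hτ : G.IsProfile τ)
    {s : List (Info × A)} (h : ∀ z ∈ G.Z, 0 ≤ w z) : 0 ≤ G.seqVal i w τ s :=
  Finset.sum_nonneg fun z hz =>
    mul_nonneg (h z (Finset.mem_filter.1 hz).1) (G.own_nonneg hτ _)

theorem mem_H_of_mem_Z {z : List A} (hz : z ∈ G.Z) : z ∈ G.H := (Finset.mem_filter.1 hz).1

variable {G} [Fintype Info]

/-- The value of a sequence is the weight that ends there plus the values of the information sets
that come next. -/
theorem seqVal_rec (hG : G.PerfectRecall) (i : P) (w : List A → ℝ) (τ : Info → A → ℝ)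
    (s : List (Info × A)) :
    G.seqVal i w τ s = ∑ z ∈ G.Z with G.playerSeq i z = s, w z +
      ∑ K with G.owner K = i ∧ G.seqI K = s, G.infoVal i w τ K := by
  have hterm : ∀ z ∈ G.Z,
      (if s <+: G.playerSeq i z then
        w z * own τ ((G.playerSeq i z).drop s.length) else 0) =
      (if G.playerSeq i z = s then w z else 0) +
      ∑ K, ∑ c, if s ++ [(K, c)] <+: G.playerSeq i z then
        τ K c * (w z * own τ ((G.playerSeq i z).drop (s.length + 1))) else 0 := by
    intro z hz
    by_cases hs : s <+: G.playerSeq i z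
    · obtain ⟨t, ht⟩ := hs
      rw [← ht]
      cases t with
      | nil =>
        have hno : ∀ K c, ¬ s ++ [(K, c)] <+: s := fun K c h => by simpa using h.length_le
        simp [hno]
      | cons p t =>
        obtain ⟨K, c⟩ := p
        have h1 : ∀ K' c', s ++ [(K', c')] <+: s ++ (K, c) :: t ↔ K' = K ∧ c' = c := by
          intro K' c'
          rw [List.prefix_append_right_inj, List.cons_prefix_cons]
          simp
        rw [Finset.sum_eq_single K, Finset.sum_eq_single c]
        · simp [own_cons, ← List.drop_drop]; ring
        · intro b _ hb; simp [h1, hb]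
        · simp
        · intro b _ hb; simp [h1, hb]
        · simp
    · have hno : ∀ K c, ¬ s ++ [(K, c)] <+: G.playerSeq i z := fun K c h =>
        hs ((List.prefix_append _ _).trans h)
      have : G.playerSeq i z ≠ s := fun h => hs (h ▸ List.prefix_refl _)
      simp [hs, hno, this]
  rw [seqVal, Finset.sum_filter, Finset.sum_congr rfl hterm, Finset.sum_add_distrib,
    Finset.sum_filter]
  congr 1
  rw [Finset.sum_comm, Finset.sum_filter]
  refine Finset.sum_congr rfl fun K _ => ?_
  rw [Finset.sum_comm]
  split_ifs with hK
  · obtain ⟨rfl, rfl⟩ := hK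
    rw [infoVal]
    symm
    refine Finset.sum_subset_zero_on_sdiff (Finset.subset_univ _) (fun c hc => ?_)
      fun c hc => ?_
    · refine Finset.sum_eq_zero fun z hz => if_neg fun h => ?_
      exact (Finset.mem_sdiff.1 hc).2 (prefix_playerSeq hG (G.mem_H_of_mem_Z hz) h).2.2
    · rw [seqVal, Finset.mul_sum, Finset.sum_filter]
      simp [seqA]
  · refine Finset.sum_eq_zero fun c _ => Finset.sum_eq_zero fun z hz => if_neg fun h => hK ?_
    obtain ⟨h1, h2, _⟩ := prefix_playerSeq hG (G.mem_H_of_mem_Z hz) h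
    exact ⟨h1, h2.symm⟩

/-- Backward induction along the sequences of a player. -/
theorem seq_induction {p : List (Info × A) → Prop}
    (h : ∀ s, (∀ K c, G.seqI K = s → p (G.seqA K c)) → p s) (s : List (Info × A)) : p s := by
  obtain ⟨N, hN⟩ : ∃ N, ∀ K, (G.seqI K).length ≤ N :=
    ⟨Finset.univ.sup fun K => (G.seqI K).length, fun K =>
      Finset.le_sup (f := fun K => (G.seqI K).length) (Finset.mem_univ K)⟩
  have key : ∀ n s, N + 1 ≤ s.length + n → p s := by
    intro n
    induction n with
    | zero =>
      intro s hs
      refine h s fun K c hK => absurd (hN K) ?_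
      rw [hK]; omega
    | succ n ih =>
      intro s hs
      refine h s fun K c hK => ih _ ?_
      simp only [seqA, hK, List.length_append, List.length_singleton]; omega
  exact key (N + 1) s (by omega)

theorem seqVal_congr (hG : G.PerfectRecall) {i : P} {w : List A → ℝ}
    {τ τ' : Info → A → ℝ} (s : List (Info × A))
    (hτ : ∀ K, G.owner K = i → s <+: G.seqI K → τ K = τ' K) :
    G.seqVal i w τ s = G.seqVal i w τ' s := by
  induction s using G.seq_induction with
  | h s ih =>
  rw [seqVal_rec hG, seqVal_rec hG]
  congr 1
  refine Finset.sum_congr rfl fun K hK => Finset.sum_congr rfl fun c _ => ?_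
  obtain ⟨h1, h2⟩ := (Finset.mem_filter.1 hK).2
  have h3 : s <+: G.seqA K c := by rw [seqA, h2]; exact List.prefix_append _ _
  rw [hτ K h1 (h2 ▸ List.prefix_refl _), ih K c h2 fun K' h4 h5 => hτ K' h4 (h3.trans h5)]

end

/-! ### Counterfactual values in sequence form -/

section

variable {P A Info : Type*} [Fintype A] (G : Game P A Info)

theorem reachFrom_trans (σ : Info → A → ℝ) {f g h : List A} (hfg : f <+: g) (hgh : g <+: h) :
    G.reachFrom σ f h = G.reachFrom σ f g * G.reachFrom σ g h := by
  induction h using List.reverseRecOn with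
  | nil =>
    have := List.prefix_nil.1 hgh
    subst this
    simp [reachFrom_self]
  | append_singleton h a ih =>
    rcases List.prefix_concat_iff.1 hgh with rfl | h2
    · simp [reachFrom_self]
    · rw [reachFrom_snoc _ _ h2, reachFrom_snoc _ _ (hfg.trans h2), ih h2, mul_assoc]

theorem reachFrom_step (σ : Info → A → ℝ) {h z : List A} (hz : z ∈ G.Z)
    (hh : ∃ a, h ++ [a] ∈ G.H) :
    G.reachFrom σ h z =
      ∑ a with h ++ [a] ∈ G.H, G.prob σ h a * G.reachFrom σ (h ++ [a]) z := by
  by_cases hp : h <+: z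
  · obtain ⟨t, rfl⟩ := hp
    cases t with
    | nil =>
      obtain ⟨a, ha⟩ := hh
      rw [List.append_nil] at hz
      exact absurd ha ((Finset.mem_filter.1 hz).2 a)
    | cons c t =>
      have hc : h ++ [c] <+: h ++ c :: t := by simp
      rw [Finset.sum_eq_single c]
      · rw [G.reachFrom_trans σ (List.prefix_append h [c]) hc,
          reachFrom_snoc _ _ (List.prefix_refl _), reachFrom_self, one_mul]
      · intro b _ hb
        rw [reachFrom, if_neg, mul_zero]
        rw [List.prefix_append_right_inj, List.cons_prefix_cons]
        exact fun h => hb h.1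
      · intro h
        exact absurd (G.mem_H_of_prefix (G.mem_H_of_mem_Z hz) hc) (by simpa using h)
  · rw [reachFrom, if_neg hp]
    symm
    refine Finset.sum_eq_zero fun a _ => ?_
    rw [reachFrom, if_neg (fun h1 => hp ((List.prefix_append _ _).trans h1)), mul_zero]

theorem acts_info_eq {h : List A} {i : P} (hh : ∃ a, h ++ [a] ∈ G.H) (ht : G.turn h = some i) :
    G.acts (G.info h) = Finset.univ.filter fun a => h ++ [a] ∈ G.H := by
  obtain ⟨a, ha⟩ := hh
  ext b
  simp [G.mem_acts_iff (G.mem_hist_info ha ht).1]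

theorem sum_prob {σ : Info → A → ℝ} (hσ : G.IsProfile σ) {h : List A}
    (hh : ∃ a, h ++ [a] ∈ G.H) : ∑ a with h ++ [a] ∈ G.H, G.prob σ h a = 1 := by
  cases ht : G.turn h with
  | none => simpa [prob, ht] using G.chance_sum h ht hh
  | some i => simpa [prob, ht, G.acts_info_eq hh ht] using (hσ (G.info h)).2.2

theorem exists_length_bound : ∃ N, ∀ h ∈ G.H, h.length ≤ N :=
  ⟨G.H.sup List.length, fun _ hh => Finset.le_sup (f := List.length) hh⟩

/-- Backward induction on the game tree. -/
theorem hist_induction {p : List A → Prop}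
    (hp : ∀ h ∈ G.H, (∀ a, h ++ [a] ∈ G.H → p (h ++ [a])) → p h) {h : List A} (hh : h ∈ G.H) :
    p h := by
  obtain ⟨N, hN⟩ := G.exists_length_bound
  have key : ∀ n, ∀ h ∈ G.H, N + 1 ≤ h.length + n → p h := by
    intro n
    induction n with
    | zero => intro h hh hn; have := hN h hh; omega
    | succ n ih =>
      exact fun h hh hn => hp h hh fun a ha => ih _ ha (by simp; omega)
  exact key (N + 1) h hh (by omega)

theorem sum_reachFrom {σ : Info → A → ℝ} (hσ : G.IsProfile σ) {h : List A} (hh : h ∈ G.H) :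
    ∑ z ∈ G.Z, G.reachFrom σ h z = 1 := by
  refine G.hist_induction (p := fun h => ∑ z ∈ G.Z, G.reachFrom σ h z = 1) (fun h hh ih => ?_) hh
  by_cases hn : ∃ a, h ++ [a] ∈ G.H
  · rw [Finset.sum_congr rfl fun z hz => G.reachFrom_step σ hz hn, Finset.sum_comm,
      ← G.sum_prob hσ hn]
    refine Finset.sum_congr rfl fun a ha => ?_
    rw [← Finset.mul_sum, ih a (Finset.mem_filter.1 ha).2, mul_one]
  · push Not at hn
    have hz : h ∈ G.Z := Finset.mem_filter.2 ⟨hh, hn⟩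
    rw [Finset.sum_eq_single_of_mem h hz, reachFrom_self]
    intro z hzz hne
    rw [reachFrom, if_neg]
    rintro ⟨t, rfl⟩
    cases t with
    | nil => simp at hne
    | cons c t =>
      exact hn c (G.mem_H_of_prefix (G.mem_H_of_mem_Z hzz) (by simp))

theorem exists_terminal {h : List A} (hh : h ∈ G.H) : ∃ z ∈ G.Z, h <+: z := by
  refine G.hist_induction (p := fun h => ∃ z ∈ G.Z, h <+: z) (fun h hh ih => ?_) hh
  by_cases hn : ∃ a, h ++ [a] ∈ G.H
  · obtain ⟨a, ha⟩ := hn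
    obtain ⟨z, hz, hp⟩ := ih a ha
    exact ⟨z, hz, (List.prefix_append _ _).trans hp⟩
  · push Not at hn
    exact ⟨h, Finset.mem_filter.2 ⟨hh, hn⟩, List.prefix_refl _⟩

variable {G}

/-- The counterfactual value of an action in sequence form, for arbitrary terminal payoffs `u`: each
terminal history below `seqA K c` passes through exactly one history of `K`. -/
theorem sum_reachOther_mul (hG : G.PerfectRecall) (σ : Info → A → ℝ) (u : List A → ℝ)
    (K : Info) (c : A) :
    ∑ h ∈ G.hist K, G.reachOther (G.owner K) σ h *
        ∑ z ∈ G.Z, G.reachFrom σ (h ++ [c]) z * u z =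
      G.seqVal (G.owner K) (fun z => G.reachOther (G.owner K) σ z * u z) σ (G.seqA K c) := by
  have h1 : ∀ h ∈ G.hist K, G.reachOther (G.owner K) σ h *
      ∑ z ∈ G.Z, G.reachFrom σ (h ++ [c]) z * u z =
      ∑ z ∈ G.Z, if h ++ [c] <+: z then G.reachOther (G.owner K) σ z * u z *
        own σ ((G.playerSeq (G.owner K) z).drop (G.seqA K c).length) else 0 := by
    intro h hh
    rw [Finset.mul_sum]
    refine Finset.sum_congr rfl fun z _ => ?_
    split_ifs with hp
    · have h2 := G.reachOther_mul_reachFrom (G.owner K) σ hp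
      rw [playerSeq_snoc_hist hG hh, reachOther_snoc, if_pos (G.turn_of_mem_hist hh),
        mul_one] at h2
      rw [← mul_assoc, h2]; ring
    · simp [reachFrom, hp]
  rw [Finset.sum_congr rfl h1, Finset.sum_comm, seqVal, Finset.sum_filter]
  refine Finset.sum_congr rfl fun z hz => ?_
  split_ifs with hp
  · obtain ⟨_, g, hg, hgc, _⟩ := exists_of_prefix_playerSeq (G.mem_H_of_mem_Z hz) hp
    rw [Finset.sum_eq_single_of_mem g hg, if_pos hgc]
    intro h hh hne
    refine if_neg fun hhc => hne ?_
    exact hist_unique hG hh hg ((List.prefix_append _ _).trans hhc)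
      ((List.prefix_append _ _).trans hgc)
  · refine Finset.sum_eq_zero fun h hh => if_neg fun hhc => hp ?_
    have := G.playerSeq_prefix (G.owner K) hhc
    rwa [playerSeq_snoc_hist hG hh] at this

variable (G) in
/-- The weight of a terminal history in the counterfactual values of player `i`. -/
def cfWeight (i : P) (σ : Info → A → ℝ) (z : List A) : ℝ := G.reachOther i σ z * G.payoff i z

theorem cfvA_eq (hG : G.PerfectRecall) (σ : Info → A → ℝ) (K : Info) (c : A) :
    G.cfvA σ K c =
      G.seqVal (G.owner K) (G.cfWeight (G.owner K) σ) σ (G.seqA K c) :=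
  sum_reachOther_mul hG σ _ K c

theorem cfv_eq_sum (σ : Info → A → ℝ) (K : Info) :
    G.cfv σ K = ∑ c ∈ G.acts K, σ K c * G.cfvA σ K c := by
  simp only [cfv, cfvA, Finset.mul_sum]
  conv_rhs => rw [Finset.sum_comm]
  refine Finset.sum_congr rfl fun h hh => ?_
  conv_rhs => rw [Finset.sum_comm]
  refine Finset.sum_congr rfl fun z hz => ?_
  have hn := (Finset.mem_filter.1 hh).2.1
  have ht := G.turn_of_mem_hist hh
  have hK := G.info_of_mem_hist hh
  rw [G.reachFrom_step σ hz hn, Finset.sum_mul, Finset.mul_sum, ← G.acts_info_eq hn ht, hK]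
  refine Finset.sum_congr rfl fun c _ => ?_
  simp only [prob, ht, hK, reduceCtorEq, if_false]
  ring

theorem cfv_eq (hG : G.PerfectRecall) (σ : Info → A → ℝ) (K : Info) :
    G.cfv σ K = G.infoVal (G.owner K) (G.cfWeight (G.owner K) σ) σ K := by
  simp only [cfv_eq_sum, infoVal, cfvA_eq hG]

theorem util_eq (i : P) (σ : Info → A → ℝ) :
    G.util i σ = G.seqVal i (G.cfWeight i σ) σ [] := by
  simp only [util, seqVal, List.nil_prefix, Finset.filter_true, List.length_nil, List.drop_zero,
    cfWeight]
  refine Finset.sum_congr rfl fun z _ => ?_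
  rw [G.reach_eq i]; ring

theorem reachOther_combine (i : P) (τ σ : Info → A → ℝ) {h : List A} (hh : h ∈ G.H) :
    G.reachOther i (G.combine i τ σ) h = G.reachOther i σ h := by
  induction h using List.reverseRecOn with
  | nil => simp
  | append_singleton h a ih =>
    rw [reachOther_snoc, reachOther_snoc, ih (G.mem_of_snoc_mem _ _ hh)]
    congr 1
    split_ifs with h1
    · rfl
    · cases ht : G.turn h with
      | none => simp [prob, ht]
      | some j =>
        have h2 := (G.mem_hist_info hh ht).2
        have h3 : j ≠ i := by rintro rfl; exact h1 ht
        simp [prob, ht, combine, h2, h3]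

theorem IsProfile.combine {i : P} {τ σ : Info → A → ℝ} (hτ : G.IsProfile τ)
    (hσ : G.IsProfile σ) : G.IsProfile (G.combine i τ σ) := fun K => by
  unfold Game.combine
  split_ifs
  · exact hτ K
  · exact hσ K

theorem combine_self (i : P) (σ : Info → A → ℝ) : G.combine i σ σ = σ := by
  funext K; simp [Game.combine]

theorem seqVal_congr_weight {i : P} {w w' : List A → ℝ} (τ : Info → A → ℝ)
    (s : List (Info × A)) (h : ∀ z ∈ G.Z, w z = w' z) :
    G.seqVal i w τ s = G.seqVal i w' τ s :=
  Finset.sum_congr rfl fun z hz => by rw [h z (Finset.mem_filter.1 hz).1]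

theorem infoVal_congr_weight {i : P} {w w' : List A → ℝ} (τ : Info → A → ℝ)
    (K : Info) (h : ∀ z ∈ G.Z, w z = w' z) : G.infoVal i w τ K = G.infoVal i w' τ K :=
  Finset.sum_congr rfl fun c _ => by rw [seqVal_congr_weight τ _ h]

variable [Fintype Info]

/-- Values in `⟨τ_i, σ_{-i}⟩` use only the weights from `σ` and only the strategy `τ`. -/
theorem seqVal_combine (hG : G.PerfectRecall) (i : P) (τ σ : Info → A → ℝ)
    (u : List A → ℝ) (s : List (Info × A)) :
    G.seqVal i (fun z => G.reachOther i (G.combine i τ σ) z * u z) (G.combine i τ σ) s =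
      G.seqVal i (fun z => G.reachOther i σ z * u z) τ s := by
  rw [seqVal_congr hG (τ' := τ) s fun K hK _ => by simp [Game.combine, hK]]
  exact seqVal_congr_weight _ _ fun z hz => by
    rw [reachOther_combine i τ σ (G.mem_H_of_mem_Z hz)]

theorem cfvA_combine (hG : G.PerfectRecall) {i : P} {K : Info} (hK : G.owner K = i)
    (τ σ : Info → A → ℝ) (c : A) :
    G.cfvA (G.combine i τ σ) K c = G.seqVal i (G.cfWeight i σ) τ (G.seqA K c) := by
  subst hK
  rw [cfvA_eq hG]
  exact seqVal_combine hG _ _ _ _ _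

theorem cfv_combine (hG : G.PerfectRecall) {i : P} {K : Info} (hK : G.owner K = i)
    (τ σ : Info → A → ℝ) :
    G.cfv (G.combine i τ σ) K = G.infoVal i (G.cfWeight i σ) τ K := by
  rw [cfv_eq_sum, infoVal]
  refine Finset.sum_congr rfl fun c _ => ?_
  rw [cfvA_combine hG hK]
  simp [Game.combine, hK]

theorem util_combine (hG : G.PerfectRecall) (i : P) (τ σ : Info → A → ℝ) :
    G.util i (G.combine i τ σ) = G.seqVal i (G.cfWeight i σ) τ [] := by
  rw [util_eq]
  exact seqVal_combine hG _ _ _ _ _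

variable (G) in
omit [Fintype Info] in
/-- The counterfactual probability of reaching `K`: that of the others and chance playing to `K`. -/
def visit (σ : Info → A → ℝ) (K : Info) : ℝ := ∑ h ∈ G.hist K, G.reachOther (G.owner K) σ h

/-- With constant payoffs, the value of an action does not depend on the player's strategy. -/
theorem seqVal_reachOther (hG : G.PerfectRecall) {τ σ : Info → A → ℝ} (hτ : G.IsProfile τ)
    (hσ : G.IsProfile σ) {K : Info} {c : A} (hc : c ∈ G.acts K) :
    G.seqVal (G.owner K) (G.reachOther (G.owner K) σ) τ (G.seqA K c) = G.visit σ K := by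
  have h1 := seqVal_combine hG (G.owner K) τ σ (fun _ => 1) (G.seqA K c)
  rw [← sum_reachOther_mul hG] at h1
  simp only [mul_one] at h1
  rw [← h1, visit]
  refine Finset.sum_congr rfl fun h hh => ?_
  rw [G.sum_reachFrom (hτ.combine hσ) ((G.mem_acts_iff hh c).1 hc), mul_one,
    reachOther_combine _ _ _ (Finset.mem_filter.1 hh).1]

theorem infoVal_reachOther (hG : G.PerfectRecall) {τ σ : Info → A → ℝ} (hτ : G.IsProfile τ)
    (hσ : G.IsProfile σ) (K : Info) :
    G.infoVal (G.owner K) (G.reachOther (G.owner K) σ) τ K = G.visit σ K := by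
  rw [infoVal, Finset.sum_congr rfl fun c hc => by rw [seqVal_reachOther hG hτ hσ hc],
    ← Finset.sum_mul, (hτ K).2.2, one_mul]

theorem infoVal_le_seqVal (hG : G.PerfectRecall) {τ : Info → A → ℝ} (hτ : G.IsProfile τ)
    {w : List A → ℝ} (hw : ∀ z ∈ G.Z, 0 ≤ w z) (K : Info) :
    G.infoVal (G.owner K) w τ K ≤ G.seqVal (G.owner K) w τ (G.seqI K) := by
  rw [seqVal_rec hG]
  have h1 : ∀ K' ∈ Finset.univ.filter fun K' => G.owner K' = G.owner K ∧ G.seqI K' = G.seqI K,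
      0 ≤ G.infoVal (G.owner K) w τ K' := fun K' _ =>
    Finset.sum_nonneg fun c _ => mul_nonneg ((hτ K').1 c) (G.seqVal_nonneg hτ hw)
  have h2 := Finset.single_le_sum h1 (Finset.mem_filter.2 ⟨Finset.mem_univ K, rfl, rfl⟩)
  have h3 : 0 ≤ ∑ z ∈ G.Z with G.playerSeq (G.owner K) z = G.seqI K, w z :=
    Finset.sum_nonneg fun z hz => hw z (Finset.mem_filter.1 hz).1
  linarith

/-- By perfect recall, the player acting at `K` could play so as to reach `K` with the probability
`visit σ K`, which is therefore at most `1`. -/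
theorem visit_le_one (hG : G.PerfectRecall) {σ : Info → A → ℝ} (hσ : G.IsProfile σ) (K : Info) :
    G.visit σ K ≤ 1 := by
  have hw : ∀ i, ∀ z ∈ G.Z, 0 ≤ G.reachOther i σ z := fun i z hz =>
    G.reachOther_nonneg i hσ (G.mem_H_of_mem_Z hz)
  have key : ∀ n K, (G.seqI K).length = n → G.visit σ K ≤ 1 := by
    intro n
    induction n with
    | zero =>
      intro K hK
      rw [← infoVal_reachOther hG hσ hσ]
      refine (infoVal_le_seqVal hG hσ (hw _) K).trans ?_
      rw [List.length_eq_zero_iff.1 hK, ← G.sum_reachFrom hσ G.nil_mem]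
      simp only [seqVal, List.nil_prefix, Finset.filter_true]
      refine Finset.sum_le_sum fun z hz => le_of_eq ?_
      have := G.reachOther_mul_reachFrom (G.owner K) σ (List.nil_prefix (l := z))
      simpa using this.symm
    | succ n ih =>
      intro K hK
      rw [← infoVal_reachOther hG hσ hσ]
      refine (infoVal_le_seqVal hG hσ (hw _) K).trans ?_
      rcases List.eq_nil_or_concat (G.seqI K) with h0 | ⟨s, ⟨K', c⟩, hs⟩
      · simp [h0] at hK
      · rw [List.concat_eq_append] at hs
        have h0 : s ++ [(K', c)] <+: G.playerSeq (G.owner K) (G.rep K) := by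
          rw [← hs]; exact List.prefix_refl _
        obtain ⟨h1, h2, h3⟩ := prefix_playerSeq hG (Finset.mem_filter.1 (G.rep_mem K)).1 h0
        have h4 : G.seqI K = G.seqA K' c := by rw [hs, h2, seqA]
        rw [h4, ← h1, seqVal_reachOther hG hσ hσ h3]
        refine ih K' ?_
        rw [h4] at hK
        simpa [seqA] using hK
  exact key _ K rfl

/-! ### Payoff ranges -/

omit [Fintype Info] in
theorem payoffs_finite (K : Info) : (G.payoffs K).Finite := by
  refine ((G.Z.finite_toSet).image (G.payoff (G.owner K))).subset ?_
  rintro r ⟨h, _, z, hz, _, rfl⟩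
  exact ⟨z, hz, rfl⟩

omit [Fintype Info] in
theorem payoffsA_subset (K : Info) (c : A) : G.payoffsA K c ⊆ G.payoffs K := by
  rintro r ⟨h, hh, z, hz, hp, rfl⟩
  exact ⟨h, hh, z, hz, (List.prefix_append _ _).trans hp, rfl⟩

omit [Fintype Info] in
theorem payoffsA_nonempty {K : Info} {c : A} (hc : c ∈ G.acts K) : (G.payoffsA K c).Nonempty := by
  obtain ⟨z, hz, hp⟩ := G.exists_terminal ((G.mem_acts_iff (G.rep_mem K) c).1 hc)
  exact ⟨_, _, G.rep_mem K, z, hz, hp, rfl⟩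

omit [Fintype Info] in
theorem L_le_UA {K : Info} {c : A} (hc : c ∈ G.acts K) : G.L K ≤ G.UA K c := by
  obtain ⟨r, hr⟩ := payoffsA_nonempty hc
  exact (csInf_le (payoffs_finite K).bddBelow (payoffsA_subset K c hr)).trans
    (le_csSup ((payoffs_finite K).subset (payoffsA_subset K c)).bddAbove hr)

omit [Fintype Info] in
theorem UA_le_U {K : Info} {c : A} (hc : c ∈ G.acts K) : G.UA K c ≤ G.U K :=
  csSup_le_csSup (payoffs_finite K).bddAbove (payoffsA_nonempty hc) (payoffsA_subset K c)

omit [Fintype Info] in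
theorem payoff_mem {K : Info} {c : A} {z : List A} (hz : z ∈ G.Z)
    (hp : G.seqA K c <+: G.playerSeq (G.owner K) z) :
    G.payoff (G.owner K) z ∈ G.payoffsA K c := by
  obtain ⟨_, g, hg, hgc, _⟩ := exists_of_prefix_playerSeq (G.mem_H_of_mem_Z hz) hp
  exact ⟨g, hg, z, hz, hgc, rfl⟩

omit [Fintype Info] in
theorem payoff_le_UA {K : Info} {c : A} {z : List A} (hz : z ∈ G.Z)
    (hp : G.seqA K c <+: G.playerSeq (G.owner K) z) : G.payoff (G.owner K) z ≤ G.UA K c :=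
  le_csSup ((payoffs_finite K).subset (payoffsA_subset K c)).bddAbove (payoff_mem hz hp)

theorem cfvA_le (hG : G.PerfectRecall) {σ : Info → A → ℝ} (hσ : G.IsProfile σ) {K : Info} {c : A}
    (hc : c ∈ G.acts K) : G.cfvA σ K c ≤ G.U K * G.visit σ K := by
  rw [cfvA_eq hG, ← seqVal_reachOther hG hσ hσ hc, ← seqVal_const_mul]
  refine G.seqVal_le hσ fun z hz hp => ?_
  rw [cfWeight, mul_comm]
  exact mul_le_mul_of_nonneg_right ((payoff_le_UA hz hp).trans (UA_le_U hc))
    (G.reachOther_nonneg _ hσ (G.mem_H_of_mem_Z hz))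

theorem le_cfvA (hG : G.PerfectRecall) {σ : Info → A → ℝ} (hσ : G.IsProfile σ) {K : Info} {c : A}
    (hc : c ∈ G.acts K) : G.L K * G.visit σ K ≤ G.cfvA σ K c := by
  rw [cfvA_eq hG, ← seqVal_reachOther hG hσ hσ hc, ← seqVal_const_mul]
  refine G.seqVal_le hσ fun z hz hp => ?_
  rw [cfWeight, mul_comm (G.reachOther _ _ _)]
  exact mul_le_mul_of_nonneg_right
    (csInf_le (payoffs_finite K).bddBelow (payoffsA_subset K c (payoff_mem hz hp)))
    (G.reachOther_nonneg _ hσ (G.mem_H_of_mem_Z hz))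

theorem le_cfv (hG : G.PerfectRecall) {σ : Info → A → ℝ} (hσ : G.IsProfile σ) (K : Info) :
    G.L K * G.visit σ K ≤ G.cfv σ K := by
  rw [cfv_eq_sum]
  calc G.L K * G.visit σ K = ∑ c ∈ G.acts K, σ K c * (G.L K * G.visit σ K) := by
        rw [← Finset.sum_mul, (hσ K).2.2, one_mul]
    _ ≤ _ := Finset.sum_le_sum fun c hc =>
        mul_le_mul_of_nonneg_left (le_cfvA hG hσ hc) ((hσ K).1 c)

theorem cfv_le (hG : G.PerfectRecall) {σ : Info → A → ℝ} (hσ : G.IsProfile σ) (K : Info) :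
    G.cfv σ K ≤ G.U K * G.visit σ K := by
  rw [cfv_eq_sum]
  calc _ ≤ ∑ c ∈ G.acts K, σ K c * (G.U K * G.visit σ K) := Finset.sum_le_sum fun c hc =>
        mul_le_mul_of_nonneg_left (cfvA_le hG hσ hc) ((hσ K).1 c)
    _ = _ := by rw [← Finset.sum_mul, (hσ K).2.2, one_mul]

omit [Fintype Info] in
theorem range_nonneg (K : Info) : 0 ≤ G.range K := by
  obtain ⟨c, hc⟩ := G.acts_nonempty K
  exact sub_nonneg.2 ((L_le_UA hc).trans (UA_le_U hc))

theorem sq_cfvA_sub_cfv_le (hG : G.PerfectRecall) {σ : Info → A → ℝ} (hσ : G.IsProfile σ)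
    {K : Info} {c : A} (hc : c ∈ G.acts K) :
    (G.cfvA σ K c - G.cfv σ K) ^ 2 ≤ G.range K ^ 2 := by
  have h1 := le_cfvA hG hσ hc
  have h2 := cfvA_le hG hσ hc
  have h3 := le_cfv hG hσ K
  have h4 := cfv_le hG hσ K
  have h5 : G.range K * G.visit σ K ≤ G.range K :=
    mul_le_of_le_one_right (range_nonneg K) (visit_le_one hG hσ K)
  rw [range] at h5 ⊢
  refine sq_le_sq' ?_ ?_ <;> nlinarith

end

/-! ### Minimal near best responses -/

section

/-- Among the mixtures over `S` of the values `c` whose positive regrets have a sum of squares of at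
most `y` there is one of minimal value, and the minimal value is monotone in `c` and antitone in
`y`. -/
theorem exists_min_mixture {A : Type*} {S : Finset A} (hS : S.Nonempty) (c : A → ℝ) {y : ℝ}
    (hy : 0 ≤ y) :
    ∃ p : A → ℝ, ((∀ b, 0 ≤ p b) ∧ (∀ b, b ∉ S → p b = 0) ∧ ∑ b ∈ S, p b = 1) ∧
      ∑ b ∈ S, max (c b - ∑ b ∈ S, p b * c b) 0 ^ 2 ≤ y ∧
      ∀ (c₀ p₀ : A → ℝ) (y₀ : ℝ), (∀ b ∈ S, c b ≤ c₀ b) → y₀ ≤ y → (∀ b ∈ S, 0 ≤ p₀ b) →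
        ∑ b ∈ S, p₀ b = 1 → ∑ b ∈ S, max (c₀ b - ∑ b ∈ S, p₀ b * c₀ b) 0 ^ 2 ≤ y₀ →
        ∑ b ∈ S, p b * c b ≤ ∑ b ∈ S, p₀ b * c₀ b := by
  obtain ⟨m, hm, hmin⟩ := S.exists_min_image c hS
  obtain ⟨M, hM, hmax⟩ := S.exists_max_image c hS
  -- The feasible values form a compact set, which contains `c M`.
  let V : Set ℝ := Set.Icc (c m) (c M) ∩ {v | ∑ b ∈ S, max (c b - v) 0 ^ 2 ≤ y}
  have hVc : IsCompact V := isCompact_Icc.inter_right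
    (isClosed_le (by fun_prop) continuous_const)
  have hVM : c M ∈ V := by
    refine ⟨⟨hmin M hM, le_rfl⟩, ?_⟩
    rw [Set.mem_ofPred_eq, Finset.sum_eq_zero]
    · exact hy
    · intro b hb
      rw [max_eq_right (sub_nonpos.2 (hmax b hb))]; simp
  obtain ⟨v, ⟨⟨hv1, hv2⟩, hv3⟩, hv⟩ := hVc.exists_isLeast ⟨_, hVM⟩
  -- Mixing a smallest and a largest value gives the value `v`.
  obtain ⟨r, s, hr, hs, hrs, hrv⟩ : v ∈ segment ℝ (c m) (c M) := by
    rw [segment_eq_Icc (hmin M hM)]; exact ⟨hv1, hv2⟩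
  have hpv : ∑ b ∈ S, ((if b = m then r else 0) + (if b = M then s else 0)) * c b = v := by
    simp only [add_mul, ite_mul, zero_mul, Finset.sum_add_distrib, Finset.sum_ite_eq', hm, hM,
      if_true]
    simpa using hrv
  refine ⟨fun b => (if b = m then r else 0) + (if b = M then s else 0), ⟨fun b => ?_, fun b hb => ?_,
    ?_⟩, ?_, ?_⟩
  · positivity
  · have h1 : b ≠ m := by rintro rfl; exact hb hm
    have h2 : b ≠ M := by rintro rfl; exact hb hM
    simp [h1, h2]
  · simp [Finset.sum_add_distrib, hm, hM, hrs]
  · rw [hpv]; exact hv3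
  · intro c₀ p₀ y₀ hc hy₀ hp hp1 hreg
    rw [hpv]
    set v₀ := ∑ b ∈ S, p₀ b * c₀ b with hv₀
    rcases le_total (c M) v₀ with h | h
    · exact hv2.trans h
    · refine hv ⟨⟨?_, h⟩, ?_⟩
      · calc c m = ∑ b ∈ S, p₀ b * c m := by rw [← Finset.sum_mul, hp1, one_mul]
          _ ≤ v₀ := Finset.sum_le_sum fun b hb =>
            mul_le_mul_of_nonneg_left ((hmin b hb).trans (hc b hb)) (hp b hb)
      · refine le_trans (Finset.sum_le_sum fun b hb => ?_) (hreg.trans hy₀)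
        have h1 : max (c b - v₀) 0 ≤ max (c₀ b - v₀) 0 :=
          max_le_max (sub_le_sub_right (hc b hb) _) le_rfl
        exact pow_le_pow_left₀ (le_max_right _ _) h1 2

variable {P A Info : Type*} [Fintype A] (G : Game P A Info)

/-- The strategy of player `i` in `τ` is a near best response for the terminal weights `w`: at every
information set `K` of `i`, the sum of the squares of the positive regrets is at most `y K`. -/
def IsNear (i : P) (w : List A → ℝ) (y : Info → ℝ) (τ : Info → A → ℝ) : Prop :=
  G.IsProfile τ ∧ ∀ K, G.owner K = i →
    ∑ b ∈ G.acts K, max (G.seqVal i w τ (G.seqA K b) - G.infoVal i w τ K) 0 ^ 2 ≤ y K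

variable {G} [Fintype Info]

/-- Some near best response has minimal values at all sequences at once. Its values are also at most
those of the near best responses of a problem with larger weights and smaller tolerances. -/
theorem exists_minimal_near (hG : G.PerfectRecall) (i : P) (w : List A → ℝ) {y : Info → ℝ}
    (hy : ∀ K, 0 ≤ y K) :
    ∃ τ, G.IsNear i w y τ ∧ ∀ (w₀ : List A → ℝ) (y₀ : Info → ℝ) (τ₀ : Info → A → ℝ),
      G.IsNear i w₀ y₀ τ₀ → ∀ s : List (Info × A),
      (∀ z ∈ G.Z, s <+: G.playerSeq i z → w z ≤ w₀ z) →
      (∀ K, G.owner K = i → s <+: G.seqI K → y₀ K ≤ y K) →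
      G.seqVal i w τ s ≤ G.seqVal i w₀ τ₀ s ∧
        ∀ K, G.owner K = i → G.seqI K = s → G.infoVal i w τ K ≤ G.infoVal i w₀ τ₀ K := by
  choose p hp1 hp2 hp3 using fun (K : Info) (c : A → ℝ) =>
    exists_min_mixture (G.acts_nonempty K) c (hy K)
  -- The locally optimal mixtures are put together by backward induction.
  obtain ⟨τ, hτ, hτp⟩ : ∃ τ, G.IsProfile τ ∧
      ∀ K, τ K = p K fun b => G.seqVal i w τ (G.seqA K b) := by
    obtain ⟨N, hN⟩ : ∃ N, ∀ K, (G.seqI K).length ≤ N :=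
      ⟨Finset.univ.sup fun K => (G.seqI K).length, fun K =>
        Finset.le_sup (f := fun K => (G.seqI K).length) (Finset.mem_univ K)⟩
    have key : ∀ n, ∃ τ, G.IsProfile τ ∧ ∀ K, N + 1 ≤ (G.seqI K).length + n →
        τ K = p K fun b => G.seqVal i w τ (G.seqA K b) := by
      intro n
      induction n with
      | zero =>
        refine ⟨fun K => p K 0, fun K => hp1 K 0, fun K hK => ?_⟩
        have := hN K
        omega
      | succ n ih =>
        obtain ⟨τ, hτ, h⟩ := ih
        refine ⟨fun K => p K fun b => G.seqVal i w τ (G.seqA K b), fun K => hp1 K _,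
          fun K hK => ?_⟩
        refine congrArg (p K) (funext fun b => ?_)
        refine seqVal_congr hG _ fun K' _ h2 => h K' ?_
        have := h2.length_le
        simp only [seqA, List.length_append, List.length_singleton] at this
        omega
    obtain ⟨τ, hτ, h⟩ := key (N + 1)
    exact ⟨τ, hτ, fun K => h K (by omega)⟩
  refine ⟨τ, ⟨hτ, fun K _ => ?_⟩, fun w₀ y₀ τ₀ h₀ => ?_⟩
  · have := hp2 K fun b => G.seqVal i w τ (G.seqA K b)
    rwa [← hτp K] at this
  · have hinfo : ∀ K, G.owner K = i → y₀ K ≤ y K →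
        (∀ b, G.seqVal i w τ (G.seqA K b) ≤ G.seqVal i w₀ τ₀ (G.seqA K b)) →
        G.infoVal i w τ K ≤ G.infoVal i w₀ τ₀ K := by
      intro K hK hyK hb
      have := hp3 K (fun b => G.seqVal i w τ (G.seqA K b))
        (fun b => G.seqVal i w₀ τ₀ (G.seqA K b)) (τ₀ K) (y₀ K) (fun b _ => hb b) hyK
        (fun b _ => (h₀.1 K).1 b) (h₀.1 K).2.2 (h₀.2 K hK)
      rwa [← hτp K] at this
    intro s
    induction s using G.seq_induction with
    | h s ih =>
    intro hw hyy
    have hI : ∀ K, G.owner K = i → G.seqI K = s → G.infoVal i w τ K ≤ G.infoVal i w₀ τ₀ K := by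
      intro K hK hs
      refine hinfo K hK (hyy K hK (hs ▸ List.prefix_refl _)) fun b => ?_
      have h3 : s <+: G.seqA K b := by rw [seqA, hs]; exact List.prefix_append _ _
      exact (ih K b hs (fun z hz hzs => hw z hz (h3.trans hzs))
        fun K' h4 h5 => hyy K' h4 (h3.trans h5)).1
    refine ⟨?_, hI⟩
    rw [seqVal_rec hG, seqVal_rec hG]
    refine add_le_add (Finset.sum_le_sum fun z hz => ?_) (Finset.sum_le_sum fun K hK => ?_)
    · obtain ⟨h1, h2⟩ := Finset.mem_filter.1 hz
      exact hw z h1 (h2 ▸ List.prefix_refl _)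
    · obtain ⟨h1, h2⟩ := (Finset.mem_filter.1 hK).2
      exact hI K h1 h2

/-- A common constant in all weights `ρ z`, where `ρ` are reach probabilities of the others, shifts
the values of all actions equally and so leaves the near best responses unchanged. -/
theorem IsNear.add_const_mul_reachOther (hG : G.PerfectRecall) {i : P} {w : List A → ℝ}
    {y : Info → ℝ} {τ : Info → A → ℝ} {ι : Type*} (t : Finset ι) {σ : ι → Info → A → ℝ}
    (hσ : ∀ k, G.IsProfile (σ k)) (r : ℝ) (h : G.IsNear i w y τ) :
    G.IsNear i (fun z => w z + r * ∑ k ∈ t, G.reachOther i (σ k) z) y τ := by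
  refine ⟨h.1, ?_⟩
  rintro K rfl
  refine le_trans (le_of_eq (Finset.sum_congr rfl fun b hb => ?_)) (h.2 K rfl)
  rw [seqVal_add, infoVal_add, seqVal_const_mul, infoVal_const_mul, seqVal_sum, infoVal_sum]
  simp only [infoVal_reachOther hG h.1 (hσ _), seqVal_reachOther hG h.1 (hσ _) hb]
  congr 2
  ring

end

/-! ### Regret decomposition -/

section

variable {P A Info : Type*} [Fintype A] {G : Game P A Info} [Fintype Info]

/-- The sequence of a history is empty or ends with exactly one choice `(K, c)`. -/
theorem sum_seqA_eq (hG : G.PerfectRecall) (i : P) {h : List A} (hh : h ∈ G.H) (r : ℝ) :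
    (∑ K with G.owner K = i, ∑ c ∈ G.acts K, if G.playerSeq i h = G.seqA K c then r else 0) =
      if G.playerSeq i h = [] then 0 else r := by
  rcases List.eq_nil_or_concat (G.playerSeq i h) with h0 | ⟨s, ⟨K, c⟩, hs⟩
  · simp [h0, seqA]
  · rw [List.concat_eq_append] at hs
    have h0 : s ++ [(K, c)] <+: G.playerSeq i h := by rw [hs]
    obtain ⟨h1, h2, h3⟩ := prefix_playerSeq hG hh h0
    have hs' : G.playerSeq i h = G.seqA K c := by rw [hs, h2, seqA]
    simp only [hs', seqA_inj]
    rw [Finset.sum_eq_single_of_mem K (by simp [h1]), Finset.sum_eq_single_of_mem c h3]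
    · simp [seqA]
    · intro b _ hb; simp [hb.symm]
    · intro K' _ hK'; simp [hK'.symm]

/-- The difference between the value of a strategy `τ` and any value function `F` that satisfies the
recursion of values is the sum over the information sets of the advantages of `τ` over the values
`g`, weighted by the probability with which `τ` plays to the information set. -/
theorem seqVal_nil_sub (hG : G.PerfectRecall) (i : P) (w : List A → ℝ) (τ : Info → A → ℝ)
    (F : List (Info × A) → ℝ) (g : Info → ℝ)
    (hF : ∀ s, F s = ∑ z ∈ G.Z with G.playerSeq i z = s, w z +
      ∑ K with G.owner K = i ∧ G.seqI K = s, g K) :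
    G.seqVal i w τ [] - F [] = ∑ K with G.owner K = i,
      own τ (G.seqI K) * (∑ c ∈ G.acts K, τ K c * F (G.seqA K c) - g K) := by
  have h1 : ∑ K with G.owner K = i, own τ (G.seqI K) * ∑ c ∈ G.acts K, τ K c * F (G.seqA K c) =
      (∑ z ∈ G.Z, if G.playerSeq i z = [] then 0 else w z * own τ (G.playerSeq i z)) +
      ∑ K with G.owner K = i, if G.seqI K = [] then 0 else g K * own τ (G.seqI K) := by
    have h2 : ∀ K c, own τ (G.seqI K) * (τ K c * F (G.seqA K c)) =
        (∑ z ∈ G.Z, if G.playerSeq i z = G.seqA K c then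
          w z * own τ (G.playerSeq i z) else 0) +
        ∑ K' with G.owner K' = i, if G.seqI K' = G.seqA K c then
          g K' * own τ (G.seqI K') else 0 := by
      intro K c
      have h3 : own τ (G.seqI K) * τ K c = own τ (G.seqA K c) := by
        rw [seqA, own_append, own_singleton]
      rw [← mul_assoc, h3, hF, mul_add, Finset.mul_sum, Finset.mul_sum, ← Finset.filter_filter,
        Finset.sum_filter, Finset.sum_filter (s := Finset.univ.filter _)]
      congr 1
      · refine Finset.sum_congr rfl fun z _ => ?_
        split_ifs with h <;> simp [h, mul_comm]
      · refine Finset.sum_congr rfl fun K' _ => ?_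
        split_ifs with h <;> simp [h, mul_comm]
    simp only [Finset.mul_sum, h2, Finset.sum_add_distrib]
    congr 1
    · rw [Finset.sum_congr rfl fun K _ => Finset.sum_comm, Finset.sum_comm]
      exact Finset.sum_congr rfl fun z hz => sum_seqA_eq hG i (G.mem_H_of_mem_Z hz) _
    · rw [Finset.sum_congr rfl fun K _ => Finset.sum_comm, Finset.sum_comm]
      refine Finset.sum_congr rfl fun K' hK' => ?_
      have h4 := sum_seqA_eq hG i (Finset.mem_filter.1 (G.rep_mem K')).1
        (g K' * own τ (G.seqI K'))
      have h5 : G.playerSeq i (G.rep K') = G.seqI K' := by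
        rw [seqI, (Finset.mem_filter.1 hK').2]
      rwa [h5] at h4
  simp only [mul_sub, Finset.sum_sub_distrib]
  rw [h1, hF [], ← Finset.filter_filter, Finset.sum_filter,
    Finset.sum_filter (s := Finset.univ.filter _)]
  have h6 : G.seqVal i w τ [] = ∑ z ∈ G.Z, w z * own τ (G.playerSeq i z) := by
    simp [seqVal]
  rw [h6]
  have h7 : ∑ z ∈ G.Z, w z * own τ (G.playerSeq i z) =
      (∑ z ∈ G.Z, if G.playerSeq i z = [] then 0 else w z * own τ (G.playerSeq i z)) +
      ∑ z ∈ G.Z, if G.playerSeq i z = [] then w z else 0 := by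
    rw [← Finset.sum_add_distrib]
    refine Finset.sum_congr rfl fun z _ => ?_
    split_ifs with h <;> simp [h]
  have h8 : ∑ K with G.owner K = i, own τ (G.seqI K) * g K =
      (∑ K with G.owner K = i, if G.seqI K = [] then 0 else g K * own τ (G.seqI K)) +
      ∑ K with G.owner K = i, if G.seqI K = [] then g K else 0 := by
    rw [← Finset.sum_add_distrib]
    refine Finset.sum_congr rfl fun z _ => ?_
    split_ifs with h <;> simp [h, mul_comm]
  rw [h7, h8]
  ring

/-- The regret of player `i` in the game obeys the CFR bound if the cumulative regrets at the
information sets do, where these may be taken with respect to any value functions `F t` that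
satisfy the recursion of values and have the right value at the root. -/
theorem sum_util_sub_le (hG : G.PerfectRecall) (i : P) {σ : ℕ → Info → A → ℝ} (n : ℕ)
    {τ : Info → A → ℝ} (hτ : G.IsProfile τ) (F : ℕ → List (Info × A) → ℝ) (g : ℕ → Info → ℝ)
    (hF : ∀ t s, F t s = ∑ z ∈ G.Z with G.playerSeq i z = s, G.cfWeight i (σ t) z +
      ∑ K with G.owner K = i ∧ G.seqI K = s, g t K)
    (hF0 : ∀ t, F t [] = G.util i (σ t))
    (hB : ∀ K, G.owner K = i → ∀ c ∈ G.acts K,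
      ∑ t ∈ Finset.range n, (F t (G.seqA K c) - g t K) ≤
        G.range K * √((G.acts K).card : ℝ) * √(n : ℝ)) :
    ∑ t ∈ Finset.range n, (G.util i (G.combine i τ (σ t)) - G.util i (σ t)) ≤
      G.regretBound i n := by
  set B : Info → ℝ := fun K => G.range K * √((G.acts K).card : ℝ) * √(n : ℝ)
  have hB0 : ∀ K, 0 ≤ B K := fun K =>
    mul_nonneg (mul_nonneg (range_nonneg K) (Real.sqrt_nonneg _)) (Real.sqrt_nonneg _)
  have h1 : ∀ t, G.util i (G.combine i τ (σ t)) - G.util i (σ t) =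
      ∑ K with G.owner K = i, own τ (G.seqI K) *
        ∑ c ∈ G.acts K, τ K c * (F t (G.seqA K c) - g t K) := by
    intro t
    rw [util_combine hG, ← hF0, seqVal_nil_sub hG i _ τ (F t) (g t) (hF t)]
    refine Finset.sum_congr rfl fun K _ => ?_
    simp only [mul_sub, Finset.sum_sub_distrib]
    rw [← Finset.sum_mul, (hτ K).2.2, one_mul]
  simp only [h1]
  rw [regretBound]
  rw [Finset.sum_comm]
  refine Finset.sum_le_sum fun K hK => ?_
  rw [← Finset.mul_sum, Finset.sum_comm]
  simp only [← Finset.mul_sum]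
  have h2 : ∑ c ∈ G.acts K, τ K c * ∑ t ∈ Finset.range n, (F t (G.seqA K c) - g t K) ≤ B K :=
    calc _ ≤ ∑ c ∈ G.acts K, τ K c * B K := Finset.sum_le_sum fun c hc =>
          mul_le_mul_of_nonneg_left (hB K (Finset.mem_filter.1 hK).2 c hc) ((hτ K).1 c)
      _ = B K := by rw [← Finset.sum_mul, (hτ K).2.2, one_mul]
  calc _ ≤ own τ (G.seqI K) * B K := mul_le_mul_of_nonneg_left h2 (G.own_nonneg hτ _)
    _ ≤ B K := mul_le_of_le_one_left (hB0 K) (G.own_le_one hτ _)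

/-! ### The potential of regret matching -/

omit [Fintype A] [Fintype Info] in
/-- If `q` is proportional to the positive parts of the regrets `R`, then these are orthogonal to
the regrets of the next iteration, so that the potential grows by at most the squares of the
latter. -/
theorem potential_step {S : Finset A} {R q c : A → ℝ} {v : ℝ} (hq : ∑ b ∈ S, q b = 1)
    (hv : v = ∑ b ∈ S, q b * c b)
    (hR : ∀ b ∈ S, (∑ b ∈ S, max (R b) 0) * q b = max (R b) 0) :
    ∑ b ∈ S, max (R b + (c b - v)) 0 ^ 2 ≤
      ∑ b ∈ S, max (R b) 0 ^ 2 + ∑ b ∈ S, (c b - v) ^ 2 := by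
  have h0 : ∑ b ∈ S, max (R b) 0 * (c b - v) = 0 := by
    rw [Finset.sum_congr rfl fun b hb => by rw [← hR b hb, mul_assoc], ← Finset.mul_sum]
    simp only [mul_sub, Finset.sum_sub_distrib]
    rw [← Finset.sum_mul, hq, one_mul, hv]
    simp
  calc ∑ b ∈ S, max (R b + (c b - v)) 0 ^ 2
      ≤ ∑ b ∈ S, (max (R b) 0 ^ 2 + (c b - v) ^ 2 + 2 * (max (R b) 0 * (c b - v))) := by
        refine Finset.sum_le_sum fun b _ => ?_
        have h1 : max (R b + (c b - v)) 0 ≤ |max (R b) 0 + (c b - v)| :=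
          max_le ((add_le_add_left (le_max_left _ _) _).trans (le_abs_self _)) (abs_nonneg _)
        have h2 := pow_le_pow_left₀ (le_max_right _ _) h1 2
        rw [sq_abs] at h2
        linarith
    _ = _ := by rw [Finset.sum_add_distrib, ← Finset.mul_sum, h0, Finset.sum_add_distrib]; ring

omit [Fintype A] [Fintype Info] in
theorem sum_mul_regretMatching {S : Finset A} (R : A → ℝ) {b : A} (hb : b ∈ S) :
    (∑ b ∈ S, max (R b) 0) * regretMatching S R b = max (R b) 0 := by
  rw [regretMatching, if_pos hb]
  have h0 : ∀ b ∈ S, 0 ≤ max (R b) 0 := fun _ _ => le_max_right _ _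
  split_ifs with h
  · rw [mul_div_cancel₀ _ h.ne']
  · have h1 : ∑ b ∈ S, max (R b) 0 = 0 := le_antisymm (not_lt.1 h) (Finset.sum_nonneg h0)
    rw [h1, zero_mul, (Finset.sum_eq_zero_iff_of_nonneg h0).1 h1 b hb]

omit [Fintype A] [Fintype Info] in
/-- Regret matching with `a` removed and renormalized is proportional to the positive regrets of the
remaining actions. -/
theorem sum_mul_renormalized {S : Finset A} (R : A → ℝ) {a : A} (ha : a ∈ S) {q : A → ℝ}
    (hq : IsRenormalized (regretMatching S R) a q) {b : A} (hb : b ∈ S.erase a) :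
    (∑ b ∈ S.erase a, max (R b) 0) * q b = max (R b) 0 := by
  have h1 := Finset.sum_erase_eq_sub (f := fun b => max (R b) 0) ha
  obtain ⟨hba, hbS⟩ := Finset.mem_erase.1 hb
  have h2 := sum_mul_regretMatching R ha
  have h3 := sum_mul_regretMatching R hbS
  rw [h1, ← h3, ← hq.2 b hba, ← h2]
  ring

theorem sum_sq_le_range (hG : G.PerfectRecall) {σ : Info → A → ℝ} (hσ : G.IsProfile σ) (K : Info)
    {S : Finset A} (hS : S ⊆ G.acts K) :
    ∑ b ∈ S, (G.cfvA σ K b - G.cfv σ K) ^ 2 ≤ G.range K ^ 2 * (G.acts K).card :=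
  calc _ ≤ ∑ b ∈ G.acts K, (G.cfvA σ K b - G.cfv σ K) ^ 2 :=
        Finset.sum_le_sum_of_subset_of_nonneg hS fun _ _ _ => sq_nonneg _
    _ ≤ ∑ b ∈ G.acts K, G.range K ^ 2 :=
        Finset.sum_le_sum fun _ hb => sq_cfvA_sub_cfv_le hG hσ hb
    _ = _ := by rw [Finset.sum_const, nsmul_eq_mul, mul_comm]

omit [Fintype Info] in
theorem potentialBound_succ (K : Info) (t : ℕ) :
    G.potentialBound K (t + 1) = G.potentialBound K t + G.range K ^ 2 * (G.acts K).card := by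
  rw [potentialBound, potentialBound]; push_cast; ring

theorem potential_regretMatching (hG : G.PerfectRecall) {σ : Info → A → ℝ} (hσ : G.IsProfile σ)
    {K : Info} {R : A → ℝ} (hR : σ K = regretMatching (G.acts K) R) {t : ℕ}
    (h : ∑ b ∈ G.acts K, max (R b) 0 ^ 2 ≤ G.potentialBound K t) :
    ∑ b ∈ G.acts K, max (R b + (G.cfvA σ K b - G.cfv σ K)) 0 ^ 2 ≤
      G.potentialBound K (t + 1) := by
  have h1 := potential_step (hσ K).2.2 (cfv_eq_sum σ K)
    fun b hb => by rw [hR]; exact sum_mul_regretMatching R hb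
  have h2 := sum_sq_le_range hG hσ K (subset_refl (G.acts K))
  rw [potentialBound_succ]
  linarith

theorem potential_renormalized (hG : G.PerfectRecall) {σ : Info → A → ℝ} (hσ : G.IsProfile σ)
    {K : Info} {R : A → ℝ} {a : A} (ha : a ∈ G.acts K)
    (hR : IsRenormalized (regretMatching (G.acts K) R) a (σ K)) {t : ℕ}
    (h : ∑ b ∈ (G.acts K).erase a, max (R b) 0 ^ 2 ≤ G.potentialBound K t) :
    ∑ b ∈ (G.acts K).erase a, max (R b + (G.cfvA σ K b - G.cfv σ K)) 0 ^ 2 ≤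
      G.potentialBound K (t + 1) := by
  have h1 := potential_step (S := (G.acts K).erase a) (R := R) (q := σ K)
    (c := fun b => G.cfvA σ K b) (v := G.cfv σ K)
    (by rw [Finset.sum_erase _ hR.1]; exact (hσ K).2.2)
    (by rw [cfv_eq_sum, Finset.sum_erase]; simp [hR.1])
    fun b hb => sum_mul_renormalized R ha hR hb
  have h2 := sum_sq_le_range hG hσ K (Finset.erase_subset a (G.acts K))
  rw [potentialBound_succ]
  linarith

/-! ### Average strategies -/

omit [Fintype Info] in
theorem reachInfo_nonneg {σ : Info → A → ℝ} (hσ : G.IsProfile σ) (K : Info) :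
    0 ≤ G.reachInfo σ K := by
  rw [reachInfo_eq]; exact G.own_nonneg hσ _

omit [Fintype Info] in
theorem isProfile_average {σ : ℕ → Info → A → ℝ} (hσ : ∀ t, G.IsProfile (σ t)) (n : ℕ) :
    G.IsProfile (G.average σ n) := by
  intro K
  have h0 : ∀ t, 0 ≤ G.reachInfo (σ t) K := fun t => reachInfo_nonneg (hσ t) K
  by_cases hD : ∑ t ∈ Finset.range n, G.reachInfo (σ t) K = 0
  · simp only [average, hD, if_true]
    refine ⟨fun a => by split_ifs <;> positivity, fun a ha => if_neg ha, ?_⟩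
    rw [Finset.sum_congr rfl fun a ha => if_pos ha, Finset.sum_const, nsmul_eq_mul,
      mul_one_div_cancel]
    exact_mod_cast (G.acts_nonempty K).card_pos.ne'
  · simp only [average, hD, if_false]
    refine ⟨fun a => ?_, fun a ha => ?_, ?_⟩
    · exact div_nonneg (Finset.sum_nonneg fun t _ => mul_nonneg (h0 t) ((hσ t K).1 a))
        (Finset.sum_nonneg fun t _ => h0 t)
    · rw [Finset.sum_eq_zero, zero_div]
      intro t _
      rw [(hσ t K).2.1 a ha, mul_zero]
    · rw [← Finset.sum_div, Finset.sum_comm]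
      simp only [← Finset.mul_sum, (hσ _ K).2.2, mul_one]
      exact div_self hD

omit [Fintype Info] in
/-- With perfect recall, the average strategy realizes the mean of the reach probabilities. -/
theorem own_average (hG : G.PerfectRecall) {σ : ℕ → Info → A → ℝ} (hσ : ∀ t, G.IsProfile (σ t))
    (n : ℕ) (i : P) {h : List A} (hh : h ∈ G.H) :
    n * own (G.average σ n) (G.playerSeq i h) =
      ∑ t ∈ Finset.range n, own (σ t) (G.playerSeq i h) := by
  induction h using List.reverseRecOn with
  | nil => simp
  | append_singleton h a ih =>
    have ih := ih (G.mem_of_snoc_mem _ _ hh)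
    rw [playerSeq_snoc]
    split_ifs with ht
    · obtain ⟨h1, h2⟩ := G.mem_hist_info hh ht
      have h3 := hG.playerSeq_eq h1
      rw [h2] at h3
      simp only [own_append, own_singleton]
      rw [← mul_assoc, ih, h3]
      simp only [← reachInfo_eq]
      by_cases hD : ∑ t ∈ Finset.range n, G.reachInfo (σ t) (G.info h) = 0
      · rw [hD, zero_mul]
        symm
        refine Finset.sum_eq_zero fun t ht => ?_
        rw [(Finset.sum_eq_zero_iff_of_nonneg fun t _ =>
          reachInfo_nonneg (hσ t) (G.info h)).1 hD t ht, zero_mul]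
      · simp only [average, hD, if_false]
        rw [mul_div_cancel₀ _ hD]
    · simpa using ih

end

section TwoPlayers

variable {A Info : Type*} [Fintype A] {G : Game (Fin 2) A Info}

/-- With two players, the contribution of the others is that of chance, `C h`, times that of the
opponent `j`. -/
theorem exists_reachOther_eq (G : Game (Fin 2) A Info) (i : Fin 2) :
    ∃ (C : List A → ℝ) (j : Fin 2), ∀ σ h, G.reachOther i σ h = C h * own σ (G.playerSeq j h) := by
  obtain ⟨j, hj⟩ : ∃ j : Fin 2, ∀ k, k ≠ i ↔ k = j := ⟨1 - i, by revert i; decide⟩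
  refine ⟨fun h => ∏ k : Fin h.length,
    if G.turn (h.take k) = none then G.chance (h.take k) (h.get k) else 1, j, fun σ h => ?_⟩
  rw [← reachOwn_eq_own, reachOther, reachOwn, ← Finset.prod_mul_distrib]
  refine Finset.prod_congr rfl fun k _ => ?_
  cases ht : G.turn (h.take k) with
  | none => simp [prob, ht]
  | some l =>
    by_cases hl : l = i
    · have : l ≠ j := fun h => (hj l).2 h hl
      simp [hl, hl ▸ this]
    · have := (hj l).1 hl
      simp [this, this ▸ hl]

theorem cfWeight_average (hG : G.PerfectRecall) {σ : ℕ → Info → A → ℝ}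
    (hσ : ∀ t, G.IsProfile (σ t)) (n : ℕ) (i : Fin 2) {z : List A} (hz : z ∈ G.Z) :
    n * G.cfWeight i (G.average σ n) z = ∑ t ∈ Finset.range n, G.cfWeight i (σ t) z := by
  obtain ⟨C, j, hC⟩ := exists_reachOther_eq G i
  simp only [cfWeight, hC]
  have := own_average hG hσ n j (G.mem_H_of_mem_Z hz)
  rw [← Finset.sum_mul, ← Finset.mul_sum, ← this]
  ring

theorem seqVal_average (hG : G.PerfectRecall) {σ : ℕ → Info → A → ℝ}
    (hσ : ∀ t, G.IsProfile (σ t)) (n : ℕ) (i : Fin 2) (τ : Info → A → ℝ) (s : List (Info × A)) :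
    n * G.seqVal i (G.cfWeight i (G.average σ n)) τ s =
      ∑ t ∈ Finset.range n, G.seqVal i (G.cfWeight i (σ t)) τ s := by
  rw [← seqVal_const_mul, ← seqVal_sum]
  exact seqVal_congr_weight τ s fun z hz => cfWeight_average hG hσ n i hz

theorem infoVal_average (hG : G.PerfectRecall) {σ : ℕ → Info → A → ℝ}
    (hσ : ∀ t, G.IsProfile (σ t)) (n : ℕ) (i : Fin 2) (τ : Info → A → ℝ) (K : Info) :
    n * G.infoVal i (G.cfWeight i (G.average σ n)) τ K =
      ∑ t ∈ Finset.range n, G.infoVal i (G.cfWeight i (σ t)) τ K := by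
  rw [← infoVal_const_mul, ← infoVal_sum]
  exact infoVal_congr_weight τ K fun z hz => cfWeight_average hG hσ n i hz

end TwoPlayers

/-! ### Near best response values -/

section NearBestResponse

variable {P A Info : Type*} [Fintype A] {G : Game P A Info}

theorem IsNear.congr_weight {i : P} {w w' : List A → ℝ} {y : Info → ℝ} {τ : Info → A → ℝ}
    (h : G.IsNear i w y τ) (hw : ∀ z ∈ G.Z, w z = w' z) : G.IsNear i w' y τ := by
  refine ⟨h.1, fun K hK => ?_⟩
  rw [← infoVal_congr_weight τ K hw]
  simpa only [seqVal_congr_weight τ _ hw] using h.2 K hK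

theorem IsNear.const_mul {i : P} {w : List A → ℝ} {y : Info → ℝ} {τ : Info → A → ℝ}
    (h : G.IsNear i w y τ) {r : ℝ} (hr : 0 ≤ r) :
    G.IsNear i (fun z => r * w z) (fun K => r ^ 2 * y K) τ := by
  refine ⟨h.1, fun K hK => ?_⟩
  refine le_trans (le_of_eq ?_) (mul_le_mul_of_nonneg_left (h.2 K hK) (sq_nonneg r))
  rw [Finset.mul_sum]
  refine Finset.sum_congr rfl fun b _ => ?_
  rw [seqVal_const_mul, infoVal_const_mul, ← mul_sub, ← mul_pow, mul_max_of_nonneg _ _ hr,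
    mul_zero]

variable [Fintype Info]

theorem isNearCBR_iff (hG : G.PerfectRecall) {x : Info → ℕ → ℝ} {i : P} {σ τ : Info → A → ℝ}
    {n : ℕ} : G.IsNearCBR x i σ n τ ↔
      G.IsNear i (G.cfWeight i σ) (fun K => x K n / (n : ℝ) ^ 2) τ := by
  refine and_congr Iff.rfl (forall_congr' fun K => forall_congr' fun hK => ?_)
  rw [cfv_combine hG hK]
  simp only [cfvA_combine hG hK]

/-- All the minima in the definitions of `NBV` and `NBVA` are attained by the same strategy. -/
theorem exists_isLeast_nearCBR (hG : G.PerfectRecall) {x : Info → ℕ → ℝ} {n : ℕ}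
    (hx : ∀ K, 0 ≤ x K n) (i : P) (σ : Info → A → ℝ) :
    ∃ τ, G.IsNear i (G.cfWeight i σ) (fun K => x K n / (n : ℝ) ^ 2) τ ∧
      ∀ K, G.owner K = i →
        IsLeast {r | ∃ σ', G.IsNearCBR x (G.owner K) σ n σ' ∧
          G.cfv (G.combine (G.owner K) σ' σ) K = r} (G.infoVal i (G.cfWeight i σ) τ K) ∧
        ∀ b, IsLeast {r | ∃ σ', G.IsNearCBR x (G.owner K) σ n σ' ∧
          G.cfvA (G.combine (G.owner K) σ' σ) K b = r}
            (G.seqVal i (G.cfWeight i σ) τ (G.seqA K b)) := by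
  obtain ⟨τ, hτ, hmin⟩ := exists_minimal_near hG i (G.cfWeight i σ)
    (y := fun K => x K n / (n : ℝ) ^ 2) fun K => div_nonneg (hx K) (sq_nonneg _)
  have hmin' := fun τ₀ h₀ s => hmin _ _ τ₀ h₀ s (fun _ _ _ => le_rfl) fun _ _ _ => le_rfl
  refine ⟨τ, hτ, ?_⟩
  rintro K rfl
  refine ⟨⟨⟨τ, (isNearCBR_iff hG).2 hτ, cfv_combine hG rfl _ _⟩, ?_⟩,
    fun b => ⟨⟨τ, (isNearCBR_iff hG).2 hτ, cfvA_combine hG rfl _ _ _⟩, ?_⟩⟩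
  · rintro _ ⟨τ₀, h₀, rfl⟩
    rw [cfv_combine hG rfl]
    exact (hmin' τ₀ ((isNearCBR_iff hG).1 h₀) _).2 K rfl rfl
  · rintro _ ⟨τ₀, h₀, rfl⟩
    rw [cfvA_combine hG rfl]
    exact (hmin' τ₀ ((isNearCBR_iff hG).1 h₀) _).1

theorem exists_nearCBR_eq_NBV (hG : G.PerfectRecall) {x : Info → ℕ → ℝ} {n : ℕ}
    (hx : ∀ K, 0 ≤ x K n) (i : P) (σ : Info → A → ℝ) :
    ∃ τ, G.IsNear i (G.cfWeight i σ) (fun K => x K n / (n : ℝ) ^ 2) τ ∧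
      ∀ K, G.owner K = i → G.NBV x σ n K = G.infoVal i (G.cfWeight i σ) τ K ∧
        ∀ b, G.NBVA x σ n K b = G.seqVal i (G.cfWeight i σ) τ (G.seqA K b) := by
  obtain ⟨τ, hτ, hleast⟩ := exists_isLeast_nearCBR hG hx i σ
  exact ⟨τ, hτ, fun K hK =>
    ⟨(hleast K hK).1.csInf_eq, fun b => ((hleast K hK).2 b).csInf_eq⟩⟩

theorem NBVA_le (hG : G.PerfectRecall) {x : Info → ℕ → ℝ} {n : ℕ}
    (hx : ∀ K, 0 ≤ x K n) {K : Info} {σ τ : Info → A → ℝ} (b : A)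
    (hτ : G.IsNear (G.owner K) (G.cfWeight (G.owner K) σ) (fun K => x K n / (n : ℝ) ^ 2) τ) :
    G.NBVA x σ n K b ≤ G.seqVal (G.owner K) (G.cfWeight (G.owner K) σ) τ (G.seqA K b) := by
  obtain ⟨_, _, hleast⟩ := exists_isLeast_nearCBR hG hx (G.owner K) σ
  exact csInf_le ((hleast K rfl).2 b).bddBelow
    ⟨τ, (isNearCBR_iff hG).2 hτ, cfvA_combine hG rfl _ _ _⟩

end NearBestResponse

section Pruning

variable {A Info : Type*} [Fintype A] [Fintype Info] {G : Game (Fin 2) A Info}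

/-- In `m` more iterations, the cumulative near best response value of an action grows by at most
its maximal payoff times the total counterfactual probability of reaching the information set. -/
theorem mul_NBVA_add_le (hG : G.PerfectRecall) {x : Info → ℕ → ℝ} (hx : ∀ J n, 0 ≤ x J n)
    {σ : ℕ → Info → A → ℝ} (hσ : ∀ t, G.IsProfile (σ t)) {n : ℕ} (hn : 1 ≤ n) (m : ℕ)
    {I : Info} {a : A} (ha : a ∈ G.acts I) (hmono : ∀ J ∈ G.D I a, x J n ≤ x J (n + m)) :
    (n + m : ℕ) * G.NBVA x (G.average σ (n + m)) (n + m) I a ≤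
      n * G.NBVA x (G.average σ n) n I a +
        G.UA I a * ∑ t ∈ Finset.range m, G.visit (σ (n + t)) I := by
  set i := G.owner I with hi
  have hn0 : (n : ℝ) ≠ 0 := by exact_mod_cast (by omega : n ≠ 0)
  have hnm0 : ((n + m : ℕ) : ℝ) ≠ 0 := by exact_mod_cast (by omega : n + m ≠ 0)
  let w₀ : List A → ℝ := fun z => ∑ t ∈ Finset.range n, G.cfWeight i (σ t) z
  let ρ : List A → ℝ := fun z => ∑ t ∈ Finset.range m, G.reachOther i (σ (n + t)) z
  let w₁ : List A → ℝ := fun z => ∑ t ∈ Finset.range (n + m), G.cfWeight i (σ t) z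
  -- Shifting the payoffs of the new iterations by `U(I,a)` makes them non-positive after `a`.
  obtain ⟨τ₁, hτ₁, hmin⟩ := exists_minimal_near hG i (fun z => w₁ z + -G.UA I a * ρ z)
    (y := fun K => x K (n + m)) fun K => hx K _
  have hnear : G.IsNear i w₁ (fun K => x K (n + m)) τ₁ := by
    refine (hτ₁.add_const_mul_reachOther hG (Finset.range m) (σ := fun t => σ (n + t))
      (fun t => hσ _) (G.UA I a)).congr_weight fun z _ => ?_
    simp only [ρ]; ring
  have hnear' : G.IsNear i (G.cfWeight i (G.average σ (n + m)))
      (fun K => x K (n + m) / ((n + m : ℕ) : ℝ) ^ 2) τ₁ := by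
    have h1 := (hnear.const_mul (r := ((n + m : ℕ) : ℝ)⁻¹) (by positivity)).congr_weight
      (w' := G.cfWeight i (G.average σ (n + m))) fun z hz => by
        simp only [w₁]
        rw [← cfWeight_average hG hσ (n + m) i hz, inv_mul_cancel_left₀ hnm0]
    refine ⟨h1.1, fun K hK => (h1.2 K hK).trans (le_of_eq ?_)⟩
    simp only [inv_pow, div_eq_inv_mul]
  obtain ⟨τ₀, hτ₀, hval⟩ := exists_nearCBR_eq_NBV hG (n := n) (fun K => hx K n) i (G.average σ n)
  have hnear₀ : G.IsNear i w₀ (fun K => x K n) τ₀ := by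
    have h1 := (hτ₀.const_mul (r := (n : ℝ)) (by positivity)).congr_weight
      (w' := w₀) fun z hz => cfWeight_average hG hσ n i hz
    refine ⟨h1.1, fun K hK => (h1.2 K hK).trans (le_of_eq ?_)⟩
    exact mul_div_cancel₀ _ (pow_ne_zero 2 hn0)
  have hcomp := (hmin w₀ (fun K => x K n) τ₀ hnear₀ (G.seqA I a) (fun z hz hp => ?_)
    fun K hK hp => hmono K ((mem_D_iff hG).2 ⟨hK, hp⟩)).1
  · have h1 : G.seqVal i ρ τ₁ (G.seqA I a) = ∑ t ∈ Finset.range m, G.visit (σ (n + t)) I := by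
      rw [seqVal_sum]
      exact Finset.sum_congr rfl fun t _ => seqVal_reachOther hG hτ₁.1 (hσ _) ha
    have h2 : G.seqVal i w₀ τ₀ (G.seqA I a) = n * G.NBVA x (G.average σ n) n I a := by
      rw [(hval I rfl).2, seqVal_average hG hσ, seqVal_sum]
    have h3 : (n + m : ℕ) * G.seqVal i (G.cfWeight i (G.average σ (n + m))) τ₁ (G.seqA I a) =
        G.seqVal i w₁ τ₁ (G.seqA I a) := by
      rw [seqVal_average hG hσ, seqVal_sum]
    have h4 := mul_le_mul_of_nonneg_left (NBVA_le hG (fun K => hx K (n + m)) a hnear')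
      (Nat.cast_nonneg (α := ℝ) (n + m))
    rw [seqVal_add, seqVal_const_mul, h1, h2] at hcomp
    rw [← hi, h3] at h4
    linarith
  · simp only [w₁, w₀, ρ, Finset.sum_range_add, Finset.mul_sum]
    rw [add_assoc, ← Finset.sum_add_distrib]
    refine add_le_of_nonpos_right (Finset.sum_nonpos fun t _ => ?_)
    have h1 := mul_le_mul_of_nonneg_left (payoff_le_UA hz hp)
      (G.reachOther_nonneg i (hσ (n + t)) (G.mem_H_of_mem_Z hz))
    rw [cfWeight]
    linarith

/-- The number `m` of pruned iterations is small enough for the pruned action to remain bad. -/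
theorem mul_NBVA_le_sum_cfv (hG : G.PerfectRecall) {x : Info → ℕ → ℝ} (hx : ∀ J n, 0 ≤ x J n)
    {σ : ℕ → Info → A → ℝ} (hσ : ∀ t, G.IsProfile (σ t)) {n : ℕ} (hn : 1 ≤ n) (m : ℕ)
    {I : Info} {a : A} (ha : a ∈ G.acts I) (hmono : ∀ J ∈ G.D I a, x J n ≤ x J (n + m))
    (hcond : n * G.NBVA x (G.average σ n) n I a ≤ ∑ t ∈ Finset.range n, G.cfv (σ t) I)
    (hm : G.L I < G.UA I a → m =
      ⌊(∑ t ∈ Finset.range n, G.cfv (σ t) I - n * G.NBVA x (G.average σ n) n I a) /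
        (G.UA I a - G.L I)⌋₊) :
    (n + m : ℕ) * G.NBVA x (G.average σ (n + m)) (n + m) I a ≤
      ∑ t ∈ Finset.range (n + m), G.cfv (σ t) I := by
  have h1 := mul_NBVA_add_le hG hx hσ hn m ha hmono
  have h2 : m * (G.UA I a - G.L I) ≤
      ∑ t ∈ Finset.range n, G.cfv (σ t) I - n * G.NBVA x (G.average σ n) n I a := by
    rcases (L_le_UA ha).lt_or_eq with h | h
    · have h3 := sub_pos.2 h
      rw [← le_div_iff₀ h3]
      have h4 := Nat.floor_le (div_nonneg (sub_nonneg.2 hcond) h3.le)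
      rwa [← hm h] at h4
    · rw [h, sub_self, mul_zero]; linarith
  have h3 : G.L I * ∑ t ∈ Finset.range m, G.visit (σ (n + t)) I ≤
      ∑ t ∈ Finset.range m, G.cfv (σ (n + t)) I := by
    rw [Finset.mul_sum]
    exact Finset.sum_le_sum fun t _ => le_cfv hG (hσ _) I
  have h4 : ∑ t ∈ Finset.range m, G.visit (σ (n + t)) I ≤ m := by
    refine (Finset.sum_le_sum fun t _ => visit_le_one hG (hσ (n + t)) I).trans ?_
    simp
  have h5 := mul_le_mul_of_nonneg_right h4 (sub_nonneg.2 (L_le_UA ha))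
  rw [Finset.sum_range_add]
  linarith

end Pruning

/-! ### Potentials during pruning and after the reset -/

section Potential

variable {P A Info : Type*} [Fintype A] {G : Game P A Info}

theorem resetRegret_eq_regret {x : Info → ℕ → ℝ} {σ : ℕ → Info → A → ℝ} {I : Info} {a : A}
    {S : ℕ} {K : Info} {b : A} (hK : K ∉ G.D I a) (hb : ¬(K = I ∧ b = a)) (t : ℕ) :
    G.resetRegret x σ I a S t K b = G.regret σ t K b := by
  simp [resetRegret, regret, resetCfvA, resetCfv, hK, hb]

theorem resetRegret_succ {x : Info → ℕ → ℝ} {σ : ℕ → Info → A → ℝ} {I : Info} {a : A}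
    {S t : ℕ} (ht : S ≤ t) (K : Info) (b : A) :
    G.resetRegret x σ I a S (t + 1) K b =
      G.resetRegret x σ I a S t K b + (G.cfvA (σ t) K b - G.cfv (σ t) K) := by
  rw [resetRegret, Finset.sum_range_succ, ← resetRegret]
  simp [resetCfvA, resetCfv, not_lt.2 ht]

variable [Fintype Info]

theorem potential_regret_le (hG : G.PerfectRecall) {σ : ℕ → Info → A → ℝ}
    (hσ : ∀ t, G.IsProfile (σ t)) {K : Info} {n : ℕ}
    (h : ∀ t < n, σ t K = G.cfrStrategy σ t K) :
    ∑ b ∈ G.acts K, max (G.regret σ n K b) 0 ^ 2 ≤ G.potentialBound K n := by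
  induction n with
  | zero => simp [regret, potentialBound]
  | succ n ih =>
    have h1 := potential_regretMatching hG (hσ n) (h n (Nat.lt_succ_self n))
      (ih fun t ht => h t (ht.trans (Nat.lt_succ_self n)))
    simpa only [regret, Finset.sum_range_succ] using h1

/-- While `a` is pruned, the potential of the other actions at `I` obeys the bound; nothing is known
about the regret of `a`. -/
theorem potential_pruned_le (hG : G.PerfectRecall) {σ : ℕ → Info → A → ℝ}
    (hσ : ∀ t, G.IsProfile (σ t)) {I : Info} {a : A} (ha : a ∈ G.acts I) {n m : ℕ}
    (h : ∀ t < n, σ t I = G.cfrStrategy σ t I)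
    (hprune : ∀ t, n ≤ t → t < n + m → IsRenormalized (G.cfrStrategy σ t I) a (σ t I)) :
    ∑ b ∈ (G.acts I).erase a, max (G.regret σ (n + m) I b) 0 ^ 2 ≤
      G.potentialBound I (n + m) := by
  induction m with
  | zero =>
    exact (Finset.sum_le_sum_of_subset_of_nonneg (Finset.erase_subset _ _)
      fun _ _ _ => sq_nonneg _).trans (potential_regret_le hG hσ h)
  | succ m ih =>
    have h1 := potential_renormalized hG (hσ (n + m)) ha
      (hprune (n + m) (by omega) (by omega)) (ih fun t h1 h2 => hprune t h1 (by omega))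
    simpa only [regret, ← add_assoc, Finset.sum_range_succ] using h1

theorem potential_reset_le (hG : G.PerfectRecall) {x : Info → ℕ → ℝ} {σ : ℕ → Info → A → ℝ}
    (hσ : ∀ t, G.IsProfile (σ t)) {I : Info} {a : A} {S m : ℕ} {K : Info}
    (h0 : ∑ b ∈ G.acts K, max (G.resetRegret x σ I a S S K b) 0 ^ 2 ≤ G.potentialBound K S)
    (h : ∀ t, S ≤ t → t < S + m →
      σ t K = regretMatching (G.acts K) (G.resetRegret x σ I a S t K)) :
    ∑ b ∈ G.acts K, max (G.resetRegret x σ I a S (S + m) K b) 0 ^ 2 ≤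
      G.potentialBound K (S + m) := by
  induction m with
  | zero => exact h0
  | succ m ih =>
    have h1 := potential_regretMatching hG (hσ (S + m)) (h (S + m) (by omega) (by omega))
      (ih fun t h1 h2 => h t h1 (by omega))
    simpa only [← add_assoc, resetRegret_succ (Nat.le_add_right S m)] using h1

end Potential

section Pruning

variable {A Info : Type*} [Fintype A] [Fintype Info] {G : Game (Fin 2) A Info}

/-- The bound on the potential at every information set. The reset cannot exceed it: below the
pruned action because a near best response has small regrets, and at the pruned action because its
reset regret is not positive. -/
theorem potential_resetRegret_le (hG : G.PerfectRecall) {x : Info → ℕ → ℝ}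
    (hx : ∀ J n, 0 ≤ x J n ∧ x J n ≤ G.potentialBound J n) {σ : ℕ → Info → A → ℝ}
    (hσ : ∀ t, G.IsProfile (σ t)) {n m k : ℕ} (hn : 1 ≤ n)
    (hcfr : ∀ t < n, ∀ J, σ t J = G.cfrStrategy σ t J) {I : Info} {a : A} (ha : a ∈ G.acts I)
    (hprune : ∀ t, n ≤ t → t < n + m → G.PrunedStep σ I a t)
    (hbad : (n + m : ℕ) * G.NBVA x (G.average σ (n + m)) (n + m) I a ≤
      ∑ t ∈ Finset.range (n + m), G.cfv (σ t) I)
    (hreset : ∀ t, n + m ≤ t → t < n + m + k → ∀ J,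
      σ t J = regretMatching (G.acts J) (G.resetRegret x σ I a (n + m) t J)) (K : Info) :
    ∑ b ∈ G.acts K, max (G.resetRegret x σ I a (n + m) (n + m + k) K b) 0 ^ 2 ≤
      G.potentialBound K (n + m + k) := by
  have hI : I ∉ G.D I a := not_mem_D_self hG
  by_cases hKD : K ∈ G.D I a
  · refine potential_reset_le hG hσ ?_ fun t h1 h2 => hreset t h1 h2 K
    obtain ⟨τ, hτ, hval⟩ := exists_nearCBR_eq_NBV hG (n := n + m) (fun K => (hx K _).1)
      (G.owner K) (G.average σ (n + m))
    refine le_trans ?_ (hx K (n + m)).2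
    have hnm0 : ((n + m : ℕ) : ℝ) ≠ 0 := by exact_mod_cast (by omega : n + m ≠ 0)
    have h1 : ∀ b, max (G.resetRegret x σ I a (n + m) (n + m) K b) 0 ^ 2 =
        ((n + m : ℕ) : ℝ) ^ 2 *
          max (G.NBVA x (G.average σ (n + m)) (n + m) K b -
            G.NBV x (G.average σ (n + m)) (n + m) K) 0 ^ 2 := by
      intro b
      have h2 : G.resetRegret x σ I a (n + m) (n + m) K b = ((n + m : ℕ) : ℝ) *
          (G.NBVA x (G.average σ (n + m)) (n + m) K b -
            G.NBV x (G.average σ (n + m)) (n + m) K) := by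
        rw [resetRegret, Finset.sum_congr rfl fun s hs => by
          rw [resetCfvA, resetCfv, if_pos ⟨Finset.mem_range.1 hs, Or.inl hKD⟩,
            if_pos ⟨Finset.mem_range.1 hs, hKD⟩]]
        simp [mul_sub]
      rw [h2, ← mul_pow, mul_max_of_nonneg _ _ (Nat.cast_nonneg _), mul_zero]
    have h3 := mul_le_mul_of_nonneg_left (hτ.2 K rfl) (sq_nonneg ((n + m : ℕ) : ℝ))
    rw [mul_div_cancel₀ _ (pow_ne_zero 2 hnm0)] at h3
    simp only [h1, ← Finset.mul_sum, (hval K rfl).1, (hval K rfl).2]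
    exact h3
  · by_cases hKI : K = I
    · subst hKI
      refine potential_reset_le hG hσ ?_ fun t h1 h2 => hreset t h1 h2 K
      have h1 := potential_pruned_le hG hσ ha (fun t ht => hcfr t ht K)
        fun t h1 h2 => (hprune t h1 h2).2
      have h2 : G.resetRegret x σ K a (n + m) (n + m) K a ≤ 0 := by
        rw [resetRegret, Finset.sum_congr rfl fun s hs => by
          rw [resetCfvA, resetCfv, if_pos ⟨Finset.mem_range.1 hs, Or.inr ⟨rfl, rfl⟩⟩,
            if_neg (fun h => hI h.2)]]
        rw [Finset.sum_sub_distrib, Finset.sum_const, Finset.card_range, nsmul_eq_mul]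
        linarith
      rw [← Finset.add_sum_erase _ _ ha, max_eq_right h2]
      refine le_trans (le_of_eq ?_) h1
      rw [zero_pow two_ne_zero, zero_add]
      refine Finset.sum_congr rfl fun b hb => ?_
      rw [resetRegret_eq_regret hKD fun h => (Finset.mem_erase.1 hb).1 h.2]
    · have h1 : ∀ t b, G.resetRegret x σ I a (n + m) t K b = G.regret σ t K b := fun t b =>
        resetRegret_eq_regret hKD (fun h => hKI h.1) t
      simp only [h1]
      refine potential_regret_le hG hσ fun t ht => ?_
      rcases lt_or_ge t n with h2 | h2
      · exact hcfr t h2 K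
      · rcases lt_or_ge t (n + m) with h3 | h3
        · exact (hprune t h2 h3).1 K hKD hKI
        · rw [hreset t h3 ht K, cfrStrategy]
          congr 1
          funext b
          exact h1 t b

/-- In the decomposition of the regret, play below the pruned action in the iterations before the
reset may be replaced by the near best response that attains all the near best response values: the
regret of a player does not depend on how the values below the pruned action arise. With this
replacement, the cumulative regrets are the reset ones. -/
theorem sum_util_sub_le_resetRegret (hG : G.PerfectRecall) {x : Info → ℕ → ℝ}
    (hx : ∀ J n, 0 ≤ x J n) {σ : ℕ → Info → A → ℝ} (hσ : ∀ t, G.IsProfile (σ t)) {S k : ℕ}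
    {I : Info} {a : A} (j : Fin 2) {τ : Info → A → ℝ} (hτ : G.IsProfile τ)
    (hB : ∀ K, ∀ c ∈ G.acts K, G.resetRegret x σ I a S (S + k) K c ≤
      G.range K * √((G.acts K).card : ℝ) * √((S + k : ℕ) : ℝ)) :
    ∑ t ∈ Finset.range (S + k), (G.util j (G.combine j τ (σ t)) - G.util j (σ t)) ≤
      G.regretBound j (S + k) := by
  obtain ⟨ν, hν, hval⟩ := exists_nearCBR_eq_NBV hG (n := S) (fun K => hx K _) j (G.average σ S)
  -- The strategy whose values are used at the sequence `s` in iteration `t`.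
  let ψ : ℕ → List (Info × A) → Info → A → ℝ := fun t s =>
    if t < S ∧ j = G.owner I ∧ G.seqA I a <+: s then ν else σ t
  refine sum_util_sub_le hG j (σ := σ) (S + k) hτ (fun t s => G.seqVal j (G.cfWeight j (σ t)) (ψ t s) s)
    (fun t K => G.infoVal j (G.cfWeight j (σ t)) (ψ t (G.seqI K)) K) (fun t s => ?_) (fun t => ?_)
    fun K hK c hc => ?_
  · rw [seqVal_rec hG]
    congr 1
    refine Finset.sum_congr rfl fun K hK => ?_
    simp only [Finset.mem_filter, Finset.mem_univ, true_and] at hK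
    rw [hK.2]
  · rw [util_eq]
    simp [ψ, seqA]
  · refine le_trans (le_of_eq ?_) (hB K c hc)
    have hlater : ∀ t, S ≤ t →
        G.seqVal j (G.cfWeight j (σ t)) (ψ t (G.seqA K c)) (G.seqA K c) -
          G.infoVal j (G.cfWeight j (σ t)) (ψ t (G.seqI K)) K =
        G.resetCfvA x σ I a S t K c - G.resetCfv x σ I a S t K := by
      intro t ht
      simp only [ψ, resetCfvA, resetCfv, not_lt.2 ht, false_and, if_false]
      rw [cfvA_eq hG, cfv_eq hG, hK]
    have hA : ∑ t ∈ Finset.range S,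
        G.seqVal j (G.cfWeight j (σ t)) (ψ t (G.seqA K c)) (G.seqA K c) =
        ∑ t ∈ Finset.range S, G.resetCfvA x σ I a S t K c := by
      have h1 : (j = G.owner I ∧ G.seqA I a <+: G.seqA K c) ↔
          (K ∈ G.D I a ∨ (K = I ∧ c = a)) := by
        rw [mem_D_iff hG, hK, seqA_prefix_seqA, ← hK]
        constructor
        · rintro ⟨h1, h2 | h2⟩
          exacts [Or.inr h2, Or.inl ⟨h1, h2⟩]
        · rintro (⟨h1, h2⟩ | ⟨rfl, rfl⟩)
          exacts [⟨h1, Or.inr h2⟩, ⟨rfl, Or.inl ⟨rfl, rfl⟩⟩]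
      by_cases h2 : K ∈ G.D I a ∨ (K = I ∧ c = a)
      · have h3 := h1.2 h2
        rw [Finset.sum_congr rfl fun t ht => by
          rw [show ψ t (G.seqA K c) = ν from if_pos ⟨Finset.mem_range.1 ht, h3⟩],
          ← seqVal_average hG hσ, ← (hval K hK).2,
          Finset.sum_congr rfl fun t ht => by
            rw [resetCfvA, if_pos ⟨Finset.mem_range.1 ht, h2⟩]]
        simp
      · refine Finset.sum_congr rfl fun t _ => ?_
        rw [show ψ t (G.seqA K c) = σ t from if_neg fun h => h2 (h1.1 h.2), resetCfvA,
          if_neg fun h => h2 h.2, cfvA_eq hG, hK]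
    have hI : ∑ t ∈ Finset.range S,
        G.infoVal j (G.cfWeight j (σ t)) (ψ t (G.seqI K)) K =
        ∑ t ∈ Finset.range S, G.resetCfv x σ I a S t K := by
      have h1 : (j = G.owner I ∧ G.seqA I a <+: G.seqI K) ↔ K ∈ G.D I a := by
        rw [mem_D_iff hG, hK]
      by_cases h2 : K ∈ G.D I a
      · have h3 := h1.2 h2
        rw [Finset.sum_congr rfl fun t ht => by
          rw [show ψ t (G.seqI K) = ν from if_pos ⟨Finset.mem_range.1 ht, h3⟩],
          ← infoVal_average hG hσ, ← (hval K hK).1,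
          Finset.sum_congr rfl fun t ht => by
            rw [resetCfv, if_pos ⟨Finset.mem_range.1 ht, h2⟩]]
        simp
      · refine Finset.sum_congr rfl fun t _ => ?_
        rw [show ψ t (G.seqI K) = σ t from if_neg fun h => h2 (h1.1 h.2), resetCfv,
          if_neg fun h => h2 h.2, cfv_eq hG, hK]
    rw [resetRegret, Finset.sum_range_add, Finset.sum_range_add,
      Finset.sum_congr rfl fun t _ => hlater (S + t) (Nat.le_add_right S t),
      Finset.sum_sub_distrib, Finset.sum_sub_distrib (s := Finset.range S), hA, hI]

/-! ### From regrets to equilibria -/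

omit [Fintype Info] in
theorem util_one (hzero : ∀ z ∈ G.Z, G.payoff 1 z = -G.payoff 0 z) (σ : Info → A → ℝ) :
    G.util 1 σ = -G.util 0 σ := by
  rw [util, util, ← Finset.sum_neg_distrib]
  exact Finset.sum_congr rfl fun z hz => by rw [hzero z hz, mul_neg]

/-- In a zero-sum game, summing the regret bounds of the two players cancels the realized payoffs, so
the gains from deviating against the average profile, all non-negative, add up to at most the mean
of the bounds over time. -/
theorem equilibrium_of_regret_le (hG : G.PerfectRecall)
    (hzero : ∀ z ∈ G.Z, G.payoff 1 z = -G.payoff 0 z) {σ : ℕ → Info → A → ℝ}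
    (hσ : ∀ t, G.IsProfile (σ t)) {n : ℕ} (hn : 1 ≤ n) (B : Fin 2 → ℝ)
    (hB : ∀ i, ∀ τ, G.IsProfile τ → ∑ t ∈ Finset.range n,
      (G.util i (G.combine i τ (σ t)) - G.util i (σ t)) ≤ B i) :
    G.exploitability (G.average σ n) ≤ (∑ i, B i) / n ∧
      G.IsEpsEquilibrium (2 * max (B 0 / n) (B 1 / n)) (G.average σ n) := by
  have hn0 : (0 : ℝ) < n := by exact_mod_cast hn
  have hbr : ∀ i, ∀ τ, G.IsProfile τ → G.util i (G.combine i τ (G.average σ n)) ≤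
      B i / n + (∑ t ∈ Finset.range n, G.util i (σ t)) / n := by
    intro i τ hτ
    rw [← add_div, le_div_iff₀ hn0, mul_comm, util_combine hG, seqVal_average hG hσ]
    have := hB i τ hτ
    simp only [util_combine hG, Finset.sum_sub_distrib] at this
    linarith
  have hsum : (∑ t ∈ Finset.range n, G.util 1 (σ t)) / n =
      -((∑ t ∈ Finset.range n, G.util 0 (σ t)) / n) := by
    simp only [util_one hzero, Finset.sum_neg_distrib, neg_div]
  have hav := isProfile_average hσ n
  have hself := fun i => hbr i _ hav
  simp only [combine_self] at hself
  have hu := util_one hzero (G.average σ n)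
  constructor
  · have hsup : ∀ i, sSup {r | ∃ τ, G.IsProfile τ ∧
        G.util i (G.combine i τ (G.average σ n)) = r} ≤
        B i / n + (∑ t ∈ Finset.range n, G.util i (σ t)) / n := fun i =>
      csSup_le ⟨_, _, hav, rfl⟩ (by rintro _ ⟨τ, hτ, rfl⟩; exact hbr i τ hτ)
    have h0 := hsup 0
    have h1 := hsup 1
    rw [exploitability, Fin.sum_univ_two, Fin.sum_univ_two, add_div]
    linarith
  · intro i τ hτ
    have h0 := hself 0
    have h1 := hself 1
    have h2 := le_max_left (B 0 / n) (B 1 / n)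
    have h3 := le_max_right (B 0 / n) (B 1 / n)
    have h4 := hbr i τ hτ
    fin_cases i <;> simp only [Fin.zero_eta, Fin.mk_one] at h4 ⊢ <;> linarith

end Pruning

end Game

end

theorem theorem1 {A Info : Type*} [Fintype A] [Fintype Info] (G : Game (Fin 2) A Info)
    -- a two-player zero-sum game with perfect recall
    (hzero : ∀ z ∈ G.Z, G.payoff 1 z = -G.payoff 0 z)
    (hrecall : G.PerfectRecall)
    -- the tolerances in the definition of a near counterfactual best response
    (x : Info → ℕ → ℝ)
    (hx : ∀ J n, 0 ≤ x J n ∧ x J n ≤ G.potentialBound J n)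
    -- `σ t` is the strategy profile of iteration `t + 1`
    (σ : ℕ → Info → A → ℝ)
    (hσ : ∀ t, G.IsProfile (σ t))
    -- `T` iterations of CFR with regret matching
    (T : ℕ) (hT : 1 ≤ T)
    (hcfr : ∀ t < T, ∀ J, σ t J = G.cfrStrategy σ t J)
    -- the pruning condition
    (I : Info) (a : A) (ha : a ∈ G.acts I)
    (hcond : T * G.NBVA x (G.average σ T) T I a ≤ ∑ t ∈ Finset.range T, G.cfv (σ t) I)
    -- the number of pruned iterations (any number if the denominator vanishes)
    (T' : ℕ)
    (hT' : G.L I < G.UA I a → T' =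
      ⌊(∑ t ∈ Finset.range T, G.cfv (σ t) I - T * G.NBVA x (G.average σ T) T I a) /
        (G.UA I a - G.L I)⌋₊)
    -- the tolerances do not decrease
    (hmono : ∀ J ∈ G.D I a, x J T ≤ x J (T + T'))
    (hprune : ∀ t, T ≤ t → t < T + T' → G.PrunedStep σ I a t) :
    -- the pruning condition still holds after the pruned iterations
    (T + T' : ℕ) * G.NBVA x (G.average σ (T + T')) (T + T') I a ≤
        ∑ t ∈ Finset.range (T + T'), G.cfv (σ t) I ∧
    -- and after the reset and `T''` more iterations the bounds of CFR hold
    ∀ T'' : ℕ,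
      (∀ t, T + T' ≤ t → t < T + T' + T'' → ∀ J,
        σ t J = Game.regretMatching (G.acts J) (G.resetRegret x σ I a (T + T') t J)) →
      (∀ i, ∀ τ, G.IsProfile τ →
        ∑ t ∈ Finset.range (T + T' + T''), (G.util i (G.combine i τ (σ t)) - G.util i (σ t)) ≤
          G.regretBound i (T + T' + T'')) ∧
      G.exploitability (G.average σ (T + T' + T'')) ≤
        (∑ i, G.regretBound i (T + T' + T'')) / (T + T' + T'' : ℕ) ∧
      G.IsEpsEquilibrium
        (2 * max (G.regretBound 0 (T + T' + T'') / (T + T' + T'' : ℕ))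
          (G.regretBound 1 (T + T' + T'') / (T + T' + T'' : ℕ)))
        (G.average σ (T + T' + T'')) := by
  have hbad := Game.mul_NBVA_le_sum_cfv hrecall (fun J n => (hx J n).1) hσ hT T' ha hmono hcond hT'
  refine ⟨hbad, fun T'' hreset => ?_⟩
  have hregret : ∀ i, ∀ τ, G.IsProfile τ →
      ∑ t ∈ Finset.range (T + T' + T''), (G.util i (G.combine i τ (σ t)) - G.util i (σ t)) ≤
        G.regretBound i (T + T' + T'') := by
    intro i τ hτ
    refine Game.sum_util_sub_le_resetRegret hrecall (fun J n => (hx J n).1) hσ i hτ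
      (I := I) (a := a) fun K c hc => ?_
    have hpot := Game.potential_resetRegret_le hrecall hx hσ hT hcfr ha hprune hbad hreset K
    refine (le_max_left _ 0).trans (abs_le_of_sq_le_sq' ?_ (mul_nonneg
      (mul_nonneg (Game.range_nonneg K) (Real.sqrt_nonneg _)) (Real.sqrt_nonneg _))).2
    refine (Finset.single_le_sum (f := fun c => max (G.resetRegret x σ I a (T + T')
      (T + T' + T'') K c) 0 ^ 2) (fun _ _ => sq_nonneg _) hc).trans (hpot.trans (le_of_eq ?_))
    rw [Game.potentialBound, mul_pow, mul_pow, Real.sq_sqrt (Nat.cast_nonneg _),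
      Real.sq_sqrt (Nat.cast_nonneg _)]
  exact ⟨hregret, Game.equilibrium_of_regret_le hrecall hzero hσ (by omega) _ hregret⟩
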